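/- **Problem.** Finitely many requests arrive over time at a single location. Request $r$ has an arrival time $a(r)\ge 0$ and a polarity, positive or negative, and there are as many positive as negative requests. A solution partitions the requests into pairs of opposite polarity and matches each pair at a time $m(r)=m(r')$ with $m(r)\ge a(r)$ and $m(r')\ge a(r')$. For a delay function $D$ its cost is $\sum_r D(m(r)-a(r))$, and $\mathrm{OPT}_D$ is the optimal offline cost, the infimum of the costs of all solutions. The function $D:[0,\infty)\to\mathbb R$ satisfies $D(0)=0$ and is concave, continuous and monotonically increasing, with one-sided derivatives that are positive and bounded, and $\lim_{t\to\infty}D(t)=\infty$. **Algorithm BPSLA.** Let $f$ be a piecewise-linear function with $f(0)=0$ and (finitely or infinitely many) pieces $k=1,2,\dots$, piece $k$ running from $x_{k-1}$ to $x_k$ (where $x_0=0$, the last piece, if there is one, extends to infinity, and $x_k\to\infty$ if there are infinitely many pieces) with slope $\alpha_k>0$, where $\alpha_k\ge 2\alpha_{k+1}$. Put $y_k=f(x_k)-f(x_{k-1})$ ($y_k=\infty$ for the last piece). For every $k$ there are two counters $z_k^+$ and $z_k^-$ of capacity $y_k$, initially $0$. An arriving positive (negative) request is associated with $z_1^+$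 (with $z_1^-$). Whenever there are requests associated with $z_k^+$ and with $z_k^-$ for the same $k$, two such requests of opposite polarity are matched and removed. Otherwise, let $\mathrm{sur}_k$ be the number of positive minus the number of negative requests associated with counters of index at most $k$; simultaneously for all $k$, the counter $z_k^+$ (resp. $z_k^-$) increases at rate $\alpha_k|\mathrm{sur}_k|$ if a request is associated with it and $\mathrm{sur}_k>0$ (resp. $\mathrm{sur}_k<0$), and stays constant otherwise. When such a counter reaches its capacity $y_k$, one request associated with it moves to $z_{k+1}^+$ (resp. $z_{k+1}^-$), and both $z_k^+$ and $z_k^-$ are reset to $0$. All ties, including the order of simultaneous events, are broken arbitrarily. **Theorem.** For every delay function $D$ as above there is a piecewise-linear function $f$ as above with $f(x)\le D(x)\le 2f(x)$ for all $x\ge 0$. For every such $f$, every input and every way of breaking ties, BPSLA run with $f$ performs only finitely many steps (arrivals, matchings, moves, and waiting until the next such event) and ends with a perfect matching of the requests, whose cost with respect to the delay function $f$ is at most $36\cdot \mathrm{OPT}_f$, and whose cost with respect to $D$ is at most $72\cdot\mathrm{OPT}_D$. In particular, BPSLA is $O(1)$-competitive for every concave delay function. -/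

import Mathlib

open Filter Topology

noncomputable section

namespace ConcaveMatching

/-! ### Delay functions -/

/-- A concave delay function `D : [0, ∞) → [0, ∞)` (only the values at nonnegative arguments matter):
`D 0 = 0`, `D` is concave, continuous, increasing and unbounded, and its one-sided derivatives exist,
are positive and are bounded. -/
structure IsConcaveDelay (D : ℝ → ℝ) : Prop where
  map_zero : D 0 = 0
  concaveOn : ConcaveOn ℝ (Set.Ici 0) D
  continuousOn : ContinuousOn D (Set.Ici 0)
  monotoneOn : MonotoneOn D (Set.Ici 0)
  deriv_pos_bounded : ∃ L : ℝ,
    (∀ x, 0 ≤ x → ∃ d, 0 < d ∧ d ≤ L ∧ HasDerivWithinAt D d (Set.Ici x) x) ∧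
    (∀ x, 0 < x → ∃ d, 0 < d ∧ d ≤ L ∧ HasDerivWithinAt D d (Set.Iic x) x)
  tendsto_atTop : Tendsto D atTop atTop

/-- A piecewise linear delay function with exponentially decreasing slopes. The pieces are numbered
`0, 1, 2, …`; there are `pieces` of them, finitely or infinitely many. Piece `k` starts at `brk k` and
has slope `slope k`; it ends at `brk (k + 1)` if there is a further piece, and extends to infinity if
it is the last one. The values of `brk k` and `slope k` for `k ≥ pieces` play no role. -/
structure PiecewiseLinearDelay where
  toFun : ℝ → ℝ
  pieces : ℕ∞
  brk : ℕ → ℝ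
  slope : ℕ → ℝ
  pieces_pos : 0 < pieces
  brk_zero : brk 0 = 0
  brk_lt : ∀ k : ℕ, ((k + 1 : ℕ) : ℕ∞) < pieces → brk k < brk (k + 1)
  brk_tendsto : pieces = ⊤ → Tendsto brk atTop atTop
  slope_pos : ∀ k : ℕ, (k : ℕ∞) < pieces → 0 < slope k
  slope_halving : ∀ k : ℕ, ((k + 1 : ℕ) : ℕ∞) < pieces → 2 * slope (k + 1) ≤ slope k
  map_zero : toFun 0 = 0
  linear : ∀ (k : ℕ) (t : ℝ), (k : ℕ∞) < pieces → brk k ≤ t →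
    (((k + 1 : ℕ) : ℕ∞) < pieces → t ≤ brk (k + 1)) →
    toFun t = toFun (brk k) + slope k * (t - brk k)

namespace PiecewiseLinearDelay

/-- Piece `k` is not the last one, so that the counters of level `k` have finite capacity. -/
def HasNext (f : PiecewiseLinearDelay) (k : ℕ) : Prop := ((k + 1 : ℕ) : ℕ∞) < f.pieces

/-- The increase of the delay along piece `k`, which is the capacity of the counters of level `k`;
it is used only if `f.HasNext k` (the counters of the last level have infinite capacity). -/
def capacity (f : PiecewiseLinearDelay) (k : ℕ) : ℝ := f.toFun (f.brk (k + 1)) - f.toFun (f.brk k)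

/-- `f ≤ D ≤ 2 f` on `[0, ∞)`. -/
def Approximates (f : PiecewiseLinearDelay) (D : ℝ → ℝ) : Prop :=
  ∀ x, 0 ≤ x → f.toFun x ≤ D x ∧ D x ≤ 2 * f.toFun x

end PiecewiseLinearDelay

/-! ### Inputs, perfect matchings and the optimal cost -/

/-- An input: finitely many requests `ι` at a single location, each with an arrival time and a polarity
(`true` for positive, `false` for negative), with as many positive as negative requests.
Simultaneous arrivals are allowed. -/
structure Input (ι : Type*) [Fintype ι] where
  arrival : ι → ℝ
  polarity : ι → Bool
  arrival_nonneg : ∀ r, 0 ≤ arrival r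
  balanced : (Finset.univ.filter fun r => polarity r = true).card =
    (Finset.univ.filter fun r => polarity r = false).card

/-- A perfect matching of the requests into pairs of opposite polarity, together with the times at which
the pairs are matched. -/
structure PerfectMatching {ι : Type*} [Fintype ι] (I : Input ι) where
  partner : ι → ι
  time : ι → ℝ
  partner_partner : ∀ r, partner (partner r) = r
  polarity_partner : ∀ r, I.polarity (partner r) ≠ I.polarity r
  time_partner : ∀ r, time (partner r) = time r
  arrival_le_time : ∀ r, I.arrival r ≤ time r

/-- The cost of a matching: the sum over all requests of the delay cost of their waiting times. -/
def PerfectMatching.cost {ι : Type*} [Fintype ι] {I : Input ι} (M : PerfectMatching I)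
    (D : ℝ → ℝ) : ℝ :=
  ∑ r, D (M.time r - I.arrival r)

/-- The optimal offline cost. -/
def Input.opt {ι : Type*} [Fintype ι] (I : Input ι) (D : ℝ → ℝ) : ℝ :=
  ⨅ M : PerfectMatching I, M.cost D

/-! ### The algorithm -/

/-- The status of a request: not yet arrived, associated with its counter of level `k`
(the positive or the negative one, according to its polarity), or matched. -/
inductive Status (ι : Type*)
  | future : Status ι
  | waiting (k : ℕ) : Status ι
  | matched (partner : ι) (time : ℝ) : Status ι

/-- A configuration of the algorithm: the current time, the statuses of the requests, and the values of
the counters (`counter k true` is the positive and `counter k false` the negative counter of level `k`). -/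
structure Config (ι : Type*) where
  time : ℝ
  status : ι → Status ι
  counter : ℕ → Bool → ℝ

/-- The sign of a polarity. -/
def sgn (b : Bool) : ℤ := if b then 1 else -1

namespace Config

open Classical in
/-- The number of requests of polarity `b` associated with the counter of level `k`. -/
def count {ι : Type*} [Fintype ι] (I : Input ι) (c : Config ι) (k : ℕ) (b : Bool) : ℕ :=
  (Finset.univ.filter fun r => I.polarity r = b ∧ c.status r = Status.waiting k).card

/-- The surplus: the number of positive minus the number of negative requests on the levels up to `k`. -/
def sur {ι : Type*} [Fintype ι] (I : Input ι) (c : Config ι) (k : ℕ) : ℤ :=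
  ∑ i ∈ Finset.range (k + 1), ((c.count I i true : ℤ) - (c.count I i false : ℤ))

/-- The counter of level `k` and polarity `b` is active if some request is associated with it and the
surplus of level `k` is nonzero and has the sign of `b`. -/
def Active {ι : Type*} [Fintype ι] (I : Input ι) (c : Config ι) (k : ℕ) (b : Bool) : Prop :=
  0 < c.count I k b ∧ 0 < sgn b * c.sur I k

open Classical in
/-- The rate at which a counter increases. -/
def rate {ι : Type*} [Fintype ι] (f : PiecewiseLinearDelay) (I : Input ι) (c : Config ι)
    (k : ℕ) (b : Bool) : ℝ :=
  if c.Active I k b then f.slope k * |(c.sur I k : ℝ)| else 0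

/-- Two requests of opposite polarity are associated with counters of the same level. -/
def HasPair {ι : Type*} [Fintype ι] (I : Input ι) (c : Config ι) : Prop :=
  ∃ k, 0 < c.count I k true ∧ 0 < c.count I k false

/-- At the start the time is zero, no request has arrived and all counters are zero. -/
def init (ι : Type*) : Config ι where
  time := 0
  status := fun _ => Status.future
  counter := fun _ _ => 0

end Config

/-- One step of the algorithm BPSLA run with the piecewise linear delay function `f` on the input `I`.
All ties (which requests to match or to move, and the order of simultaneous events) may be broken
arbitrarily. The algorithm is online: apart from stopping time at the arrival of a request, a step
does not depend on the requests that have not arrived. -/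
inductive Step {ι : Type*} [Fintype ι] [DecidableEq ι] (f : PiecewiseLinearDelay) (I : Input ι) :
    Config ι → Config ι → Prop
  /-- A request arrives and is associated with the lowest counter of its polarity. -/
  | arrive (c : Config ι) (r : ι) (hr : c.status r = Status.future) (ht : I.arrival r = c.time) :
      Step f I c { c with status := Function.update c.status r (Status.waiting 0) }
  /-- Two requests of opposite polarity on the same level are matched and leave their counters. -/
  | pair (c : Config ι) (k : ℕ) (r s : ι) (hr : I.polarity r = true) (hs : I.polarity s = false)
      (hrk : c.status r = Status.waiting k) (hsk : c.status s = Status.waiting k) :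
      Step f I c { c with
        status := Function.update (Function.update c.status r (Status.matched s c.time))
          s (Status.matched r c.time) }
  /-- If there is nothing to match, and an active counter has reached its capacity, then one request
  associated with it moves up a level, and both counters of the level that it leaves are reset. -/
  | move (c : Config ι) (k : ℕ) (b : Bool) (r : ι) (hpair : ¬ c.HasPair I)
      (hk : f.HasNext k) (hact : c.Active I k b) (hfull : c.counter k b = f.capacity k)
      (hr : I.polarity r = b) (hrk : c.status r = Status.waiting k) :
      Step f I c { c with
        status := Function.update c.status r (Status.waiting (k + 1))
        counter := Function.update c.counter k (fun _ => 0) }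
  /-- If there is nothing to match, time passes until the next event, and meanwhile all counters
  increase at their rates. The next event is the first moment when a request arrives or an active
  counter reaches its capacity. -/
  | wait (c : Config ι) (δ : ℝ) (hδ : 0 < δ) (hpair : ¬ c.HasPair I)
      (hfut : ∀ r, c.status r = Status.future → c.time + δ ≤ I.arrival r)
      (hcap : ∀ k b, c.Active I k b → f.HasNext k →
        c.counter k b + δ * c.rate f I k b ≤ f.capacity k)
      (hnext : (∃ r, c.status r = Status.future ∧ c.time + δ = I.arrival r) ∨
        ∃ k b, c.Active I k b ∧ f.HasNext k ∧
          c.counter k b + δ * c.rate f I k b = f.capacity k) :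
      Step f I c { c with
        time := c.time + δ
        counter := fun k b => c.counter k b + δ * c.rate f I k b }

/-- The configurations that BPSLA, run with `f` on the input `I`, can reach in finitely many steps. -/
def Reachable {ι : Type*} [Fintype ι] [DecidableEq ι] (f : PiecewiseLinearDelay) (I : Input ι)
    (c : Config ι) : Prop :=
  Relation.ReflTransGen (Step f I) (Config.init ι) c

end ConcaveMatching

end

/-!
The existence of the approximation `f` is `IsConcaveDelay.exists_approximates`: from each breakpoint
follow the line whose slope is half the right derivative of `D`, until it returns to the graph of
`D`.

**Termination.** A counter of level `k` takes at least the length of piece `k`, divided by the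
number `n` of requests, to fill up. So a request is on level `k` only if `f.brk k` is at most `n`
times the last arrival time (after that arrival the surplus of the highest occupied level is zero,
and no new level is opened), the levels are bounded, and every request takes part in boundedly many
steps. The algorithm cannot stop early: as long as a request is unmatched, either a pair can be
matched, or an arrival is still to come, or the lowest occupied level is active and has a finite
capacity (`Valid.exists_step`).

**Cost.** Fix another perfect matching, in which each pair is matched at its later arrival, and
consider the rate `∑ ρ k` at which the counters increase. Here `α k` is the slope of piece `k`, and
`ρ k` is `α k * |sur k|` if level `k` is active and `0` otherwise.

* By concavity, a request that was matched on level `k` after waiting for a time `x` has cost at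
  most `f (brk k) + α k * x`. The first summand is paid for by the counters whose filling moved the
  request up, and the second by the rate at which requests wait on level `k`, which in total is at
  most `2 * ∑ ρ k` (`Config.sum_slope_mul_count_le`). So the algorithm pays at most three times the
  total increase of the counters.
* Let a request waiting in the other matching be on the levels whose pieces are not yet finished at
  its age, and let `o k` be the surplus of these requests. As the slopes halve, `∑ α k * |o k|` is
  at most twice the rate at which the other matching pays (`PiecewiseLinearDelay.mul_sum_slope_le`).
  Thus the increase of a counter while `|sur k| ≤ |o k|` is paid for. When `|o k| < |sur k|`, the
  difference `d k = sur k - o k` has the sign of `sur k`, and the move which the counter eventually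
  triggers brings `d k` closer to zero. `levelPotential` makes this precise: its main term is
  `|d k|` times the capacity of level `k`. The difference `d k` changes otherwise only when a request of
  the other matching ages past level `k`, and when its partner arrives afterwards, and both changes
  are paid for by the capacity of level `k` that is contained in the cost of the request.

Altogether the total increase of the counters is at most twelve times the cost of the other
matching. Both parts are combined in the single function `balance`, which is zero at the start and
which no step increases (`Step.balance_le`); at the end it bounds the cost of the algorithm.
-/

namespace ConcaveMatching

/-! ### Approximating a concave delay function -/

namespace IsConcaveDelay

variable {D : ℝ → ℝ}

/-- The right derivative of a delay function (with the junk value `0` at negative arguments). -/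
noncomputable def rightDeriv (hD : IsConcaveDelay D) (x : ℝ) : ℝ :=
  if hx : 0 ≤ x then (hD.deriv_pos_bounded.choose_spec.1 x hx).choose else 0

lemma rightDeriv_pos (hD : IsConcaveDelay D) {x : ℝ} (hx : 0 ≤ x) : 0 < hD.rightDeriv x := by
  rw [rightDeriv, dif_pos hx]
  exact (hD.deriv_pos_bounded.choose_spec.1 x hx).choose_spec.1

lemma hasDerivWithinAt_rightDeriv (hD : IsConcaveDelay D) {x : ℝ} (hx : 0 ≤ x) :
    HasDerivWithinAt D (hD.rightDeriv x) (Set.Ioi x) x := by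
  rw [rightDeriv, dif_pos hx]
  exact (hD.deriv_pos_bounded.choose_spec.1 x hx).choose_spec.2.2.mono Set.Ioi_subset_Ici_self

lemma tendsto_slope_rightDeriv (hD : IsConcaveDelay D) {x : ℝ} (hx : 0 ≤ x) :
    Tendsto (slope D x) (𝓝[>] x) (𝓝 (hD.rightDeriv x)) :=
  (hasDerivWithinAt_iff_tendsto_slope' (Set.notMem_Ioi.2 le_rfl)).1
    (hD.hasDerivWithinAt_rightDeriv hx)

lemma le_rightDeriv_tangent (hD : IsConcaveDelay D) {x y : ℝ} (hx : 0 ≤ x) (hxy : x ≤ y) :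
    D y ≤ D x + hD.rightDeriv x * (y - x) := by
  rcases hxy.eq_or_lt with rfl | hlt
  · simp
  have h := hD.concaveOn.slope_le_of_hasDerivWithinAt_Ioi (Set.mem_Ici.2 hx)
    (Set.mem_Ici.2 (hx.trans hxy)) hlt (hD.hasDerivWithinAt_rightDeriv hx)
  rw [slope_def_field, div_le_iff₀ (sub_pos.2 hlt)] at h
  linarith

lemma rightDeriv_le_slope (hD : IsConcaveDelay D) {x y : ℝ} (hx : 0 ≤ x) (hxy : x < y) :
    hD.rightDeriv y ≤ slope D x y := by
  refine le_of_tendsto (hD.tendsto_slope_rightDeriv (hx.trans hxy.le)) ?_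
  filter_upwards [self_mem_nhdsWithin] with z hz
  rw [slope_def_field, slope_def_field]
  exact hD.concaveOn.slope_anti_adjacent (Set.mem_Ici.2 hx)
    (Set.mem_Ici.2 ((hx.trans hxy.le).trans (le_of_lt hz))) hxy hz

lemma rightDeriv_anti (hD : IsConcaveDelay D) {x y : ℝ} (hx : 0 ≤ x) (hxy : x < y) :
    hD.rightDeriv y ≤ hD.rightDeriv x :=
  (hD.rightDeriv_le_slope hx hxy).trans
    (hD.concaveOn.slope_le_of_hasDerivWithinAt_Ioi (Set.mem_Ici.2 hx)
      (Set.mem_Ici.2 (hx.trans hxy.le)) hxy (hD.hasDerivWithinAt_rightDeriv hx))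

/-- The line through `(x, D x)` whose slope is half the right derivative of `D` at `x`. -/
noncomputable def halfLine (hD : IsConcaveDelay D) (x t : ℝ) : ℝ :=
  D x + hD.rightDeriv x / 2 * (t - x)

/-- If the half-slope line at `x` never returns to the graph of `D`, then it stays below it, since
`D` lies above it immediately to the right of `x`. -/
lemma halfLine_le_of_forall_ne (hD : IsConcaveDelay D) {x : ℝ} (hx : 0 ≤ x)
    (h : ∀ z, x < z → D z ≠ hD.halfLine x z) {y : ℝ} (hy : x ≤ y) : hD.halfLine x y ≤ D y := by
  by_contra! hlt
  have hxy : x < y := by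
    rcases hy.eq_or_lt with rfl | h'
    · simp [halfLine] at hlt
    · exact h'
  have hpos := hD.rightDeriv_pos hx
  have hev : ∀ᶠ z in 𝓝[>] x, hD.rightDeriv x / 2 < slope D x z :=
    (hD.tendsto_slope_rightDeriv hx).eventually_const_lt (by linarith)
  have hev2 : ∀ᶠ z in 𝓝[>] x, z ∈ Set.Ioo x y := Ioo_mem_nhdsGT hxy
  obtain ⟨z, hz1, hz2⟩ := (hev.and hev2).exists
  rw [slope_def_field, lt_div_iff₀ (sub_pos.2 hz2.1)] at hz1
  have hcont : ContinuousOn (fun w => D w - hD.halfLine x w) (Set.Icc z y) := by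
    refine ContinuousOn.sub (hD.continuousOn.mono fun w hw => ?_) ?_
    · exact Set.mem_Ici.2 (hx.trans (hz2.1.le.trans hw.1))
    · unfold halfLine
      fun_prop
  have hmem : (0 : ℝ) ∈ Set.Icc (D y - hD.halfLine x y) (D z - hD.halfLine x z) := by
    constructor
    · linarith
    · simp only [halfLine]
      linarith
  obtain ⟨w, hw, hw0⟩ := intermediate_value_Icc' hz2.2.le hcont hmem
  exact h w (hz2.1.trans_le hw.1) (by simpa [sub_eq_zero] using hw0)

open Classical in
/-- The breakpoints of the approximation: the next breakpoint is a point where the half-slope line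
returns to the graph of `D`. If there is none, the sequence stays where it is. -/
noncomputable def approxBrk (hD : IsConcaveDelay D) : ℕ → ℝ
  | 0 => 0
  | k + 1 => if h : ∃ z, hD.approxBrk k < z ∧ D z = hD.halfLine (hD.approxBrk k) z then h.choose
      else hD.approxBrk k

/-- The half-slope line at breakpoint `k` returns to the graph of `D`. -/
def ApproxReturns (hD : IsConcaveDelay D) (k : ℕ) : Prop :=
  ∃ z, hD.approxBrk k < z ∧ D z = hD.halfLine (hD.approxBrk k) z

lemma approxBrk_lt_succ (hD : IsConcaveDelay D) {k : ℕ} (h : hD.ApproxReturns k) :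
    hD.approxBrk k < hD.approxBrk (k + 1) := by
  have h' : ∃ z, hD.approxBrk k < z ∧ D z = hD.halfLine (hD.approxBrk k) z := h
  rw [approxBrk, dif_pos h']
  exact h'.choose_spec.1

lemma map_approxBrk_succ (hD : IsConcaveDelay D) {k : ℕ} (h : hD.ApproxReturns k) :
    D (hD.approxBrk (k + 1)) = hD.halfLine (hD.approxBrk k) (hD.approxBrk (k + 1)) := by
  have h' : ∃ z, hD.approxBrk k < z ∧ D z = hD.halfLine (hD.approxBrk k) z := h
  rw [approxBrk, dif_pos h']
  exact h'.choose_spec.2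

lemma approxBrk_mono (hD : IsConcaveDelay D) : Monotone hD.approxBrk := by
  refine monotone_nat_of_le_succ fun k => ?_
  by_cases h : hD.ApproxReturns k
  · exact (hD.approxBrk_lt_succ h).le
  · have h' : ¬ ∃ z, hD.approxBrk k < z ∧ D z = hD.halfLine (hD.approxBrk k) z := h
    rw [approxBrk, dif_neg h']

lemma approxBrk_nonneg (hD : IsConcaveDelay D) (k : ℕ) : 0 ≤ hD.approxBrk k := by
  simpa [approxBrk] using hD.approxBrk_mono (Nat.zero_le k)

/-- The slopes halve, because the right derivative at the next breakpoint is at most the slope of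
the chord that ends there. -/
lemma rightDeriv_approxBrk_succ_le (hD : IsConcaveDelay D) {k : ℕ} (h : hD.ApproxReturns k) :
    hD.rightDeriv (hD.approxBrk (k + 1)) ≤ hD.rightDeriv (hD.approxBrk k) / 2 := by
  have hlt := hD.approxBrk_lt_succ h
  have h1 := hD.rightDeriv_le_slope (hD.approxBrk_nonneg k) hlt
  have h2 := hD.map_approxBrk_succ h
  have h3 : slope D (hD.approxBrk k) (hD.approxBrk (k + 1)) =
      hD.rightDeriv (hD.approxBrk k) / 2 := by
    rw [slope_def_field, div_eq_iff (sub_pos.2 hlt).ne', h2, halfLine]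
    ring
  linarith

/-- Infinitely many breakpoints cannot accumulate, since the slopes tend to zero while the right
derivative of `D` is positive everywhere. -/
lemma tendsto_approxBrk (hD : IsConcaveDelay D) (h : ∀ k, hD.ApproxReturns k) :
    Tendsto hD.approxBrk atTop atTop := by
  refine tendsto_atTop_atTop_of_monotone hD.approxBrk_mono fun b => ?_
  by_contra! hb
  have hgeo : ∀ k, hD.rightDeriv (hD.approxBrk k) ≤ hD.rightDeriv 0 * (1 / 2) ^ k := by
    intro k
    induction k with
    | zero => simp [approxBrk]
    | succ k ih =>
      have := hD.rightDeriv_approxBrk_succ_le (h k)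
      rw [pow_succ]
      linarith
  have hb0 : 0 ≤ b := (hD.approxBrk_nonneg 0).trans (hb 0).le
  have hlim : Tendsto (fun k : ℕ => hD.rightDeriv 0 * (1 / 2 : ℝ) ^ k) atTop (𝓝 0) := by
    simpa using (tendsto_pow_atTop_nhds_zero_of_lt_one (by norm_num : (0 : ℝ) ≤ 1 / 2)
      (by norm_num)).const_mul (hD.rightDeriv 0)
  have := ge_of_tendsto' hlim fun k =>
    (hD.rightDeriv_anti (hD.approxBrk_nonneg k) (hb k)).trans (hgeo k)
  linarith [hD.rightDeriv_pos hb0]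

end IsConcaveDelay

lemma exists_enat_coe_lt_iff (p : ℕ → Prop) : ∃ N : ℕ∞, ∀ k : ℕ, (k : ℕ∞) < N ↔ ∀ j < k, p j := by
  classical
  by_cases h : ∃ j, ¬ p j
  · refine ⟨((Nat.find h + 1 : ℕ) : ℕ∞), fun k => ?_⟩
    rw [Nat.cast_lt, Nat.lt_succ_iff, Nat.le_find_iff]
    simp
  · push Not at h
    exact ⟨⊤, fun k => by simp [h]⟩

namespace IsConcaveDelay

variable {D : ℝ → ℝ}

open Classical in
/-- The polygon that consists of the half-slope lines on the pieces of the approximation. -/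
noncomputable def approxFun (hD : IsConcaveDelay D) (N : ℕ∞) (t : ℝ) : ℝ :=
  if h : ∃ k : ℕ, (k : ℕ∞) < N ∧ hD.approxBrk k ≤ t ∧
      (((k + 1 : ℕ) : ℕ∞) < N → t ≤ hD.approxBrk (k + 1)) then
    hD.halfLine (hD.approxBrk h.choose) t
  else 0

/-- The value of the polygon on piece `k`; neighbouring pieces agree at the common breakpoint. -/
lemma approxFun_eq (hD : IsConcaveDelay D) {N : ℕ∞}
    (hN : ∀ k : ℕ, (k : ℕ∞) < N ↔ ∀ j < k, hD.ApproxReturns j) {k : ℕ} {t : ℝ}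
    (hk : (k : ℕ∞) < N) (h1 : hD.approxBrk k ≤ t)
    (h2 : ((k + 1 : ℕ) : ℕ∞) < N → t ≤ hD.approxBrk (k + 1)) :
    hD.approxFun N t = hD.halfLine (hD.approxBrk k) t := by
  have key : ∀ i j : ℕ, i < j → (j : ℕ∞) < N → hD.approxBrk j ≤ t →
      (((i + 1 : ℕ) : ℕ∞) < N → t ≤ hD.approxBrk (i + 1)) →
      hD.halfLine (hD.approxBrk i) t = hD.halfLine (hD.approxBrk j) t := by
    intro i j hij hj hjt hit
    have hi1 : ((i + 1 : ℕ) : ℕ∞) < N := lt_of_le_of_lt (Nat.cast_le.2 hij) hj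
    have hret := (hN (i + 1)).1 hi1 i (Nat.lt_succ_self i)
    obtain rfl : j = i + 1 := by
      by_contra hne
      have hlt := hD.approxBrk_lt_succ ((hN j).1 hj (i + 1) (by omega))
      have := hD.approxBrk_mono (show i + 1 + 1 ≤ j by omega)
      linarith [hit hi1]
    obtain rfl : t = hD.approxBrk (i + 1) := le_antisymm (hit hi1) hjt
    rw [← hD.map_approxBrk_succ hret]
    simp [halfLine]
  have hex : ∃ k : ℕ, (k : ℕ∞) < N ∧ hD.approxBrk k ≤ t ∧
      (((k + 1 : ℕ) : ℕ∞) < N → t ≤ hD.approxBrk (k + 1)) := ⟨k, hk, h1, h2⟩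
  rw [approxFun, dif_pos hex]
  obtain ⟨g1, g2, g3⟩ := hex.choose_spec
  rcases lt_trichotomy hex.choose k with hlt | heq | hgt
  · exact key _ _ hlt hk h1 g3
  · rw [heq]
  · exact (key _ _ hgt g1 g2 h2).symm

/-- Every concave delay function is approximated within a factor of two by a piecewise linear delay
function with halving slopes. The approximation interpolates `D` at its breakpoints, hence lies
below `D`; and on each piece its slope is half the right derivative of `D` at the start of the
piece. -/
theorem exists_approximates (hD : IsConcaveDelay D) :
    ∃ f : PiecewiseLinearDelay, f.Approximates D := by
  obtain ⟨N, hN⟩ := exists_enat_coe_lt_iff hD.ApproxReturns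
  have hN0 : 0 < N := by
    have := (hN 0).2 (by simp)
    simpa using this
  have hbrk : ∀ k : ℕ, (k : ℕ∞) < N → hD.approxFun N (hD.approxBrk k) = D (hD.approxBrk k) := by
    intro k hk
    rw [hD.approxFun_eq hN hk le_rfl fun _ => hD.approxBrk_mono (Nat.le_succ k)]
    simp [halfLine]
  let f : PiecewiseLinearDelay :=
    { toFun := hD.approxFun N
      pieces := N
      brk := hD.approxBrk
      slope := fun k => hD.rightDeriv (hD.approxBrk k) / 2
      pieces_pos := hN0
      brk_zero := rfl
      brk_lt := fun k hk => hD.approxBrk_lt_succ ((hN (k + 1)).1 hk k (Nat.lt_succ_self k))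
      brk_tendsto := by
        intro htop
        refine hD.tendsto_approxBrk fun k => ?_
        exact (hN (k + 1)).1 (by rw [htop]; exact ENat.natCast_lt_top _) k (Nat.lt_succ_self k)
      slope_pos := fun k _ => half_pos (hD.rightDeriv_pos (hD.approxBrk_nonneg k))
      slope_halving := by
        intro k hk
        have := hD.rightDeriv_approxBrk_succ_le ((hN (k + 1)).1 hk k (Nat.lt_succ_self k))
        linarith
      map_zero := by
        have := hbrk 0 hN0
        simpa [approxBrk, hD.map_zero] using this
      linear := by
        intro k t hk h1 h2
        rw [hD.approxFun_eq hN hk h1 h2, hbrk k hk, halfLine] }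
  refine ⟨f, fun x hx => ?_⟩
  have hex : ∃ k, ((k + 1 : ℕ) : ℕ∞) < N → x ≤ hD.approxBrk (k + 1) := by
    by_contra! hcon
    have htop := hD.tendsto_approxBrk fun k =>
      (hN (k + 1)).1 (hcon k).1 k (Nat.lt_succ_self k)
    obtain ⟨k, hk⟩ := (htop.eventually_ge_atTop x).exists
    exact absurd (hk.trans (hD.approxBrk_mono (Nat.le_succ k))) (not_le.2 (hcon k).2)
  classical
  obtain ⟨k, hkN, hkx, hk1⟩ : ∃ k : ℕ, (k : ℕ∞) < N ∧ hD.approxBrk k ≤ x ∧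
      (((k + 1 : ℕ) : ℕ∞) < N → x ≤ hD.approxBrk (k + 1)) := by
    refine ⟨Nat.find hex, ?_, ?_, Nat.find_spec hex⟩
    all_goals
      rcases hfind : Nat.find hex with _ | j
      · first | simpa using hN0 | simpa [approxBrk] using hx
      · have := Nat.find_min hex (m := j) (by omega)
        push Not at this
        first | exact this.1 | exact this.2.le
  have hk0 := hD.approxBrk_nonneg k
  have hfx : f.toFun x = hD.halfLine (hD.approxBrk k) x := hD.approxFun_eq hN hkN hkx hk1
  have hslope := hD.rightDeriv_pos hk0
  have hDk : 0 ≤ D (hD.approxBrk k) := by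
    rw [← hD.map_zero]
    exact hD.monotoneOn (Set.mem_Ici.2 le_rfl) (Set.mem_Ici.2 hk0) hk0
  rw [hfx]
  constructor
  · by_cases hlast : ((k + 1 : ℕ) : ℕ∞) < N
    · -- On a bounded piece the approximation is a chord of the concave function `D`.
      have hret := (hN (k + 1)).1 hlast k (Nat.lt_succ_self k)
      have hlt := hD.approxBrk_lt_succ hret
      have hend := hD.map_approxBrk_succ hret
      set u := hD.approxBrk k
      set v := hD.approxBrk (k + 1)
      have hvu : 0 < v - u := sub_pos.2 hlt
      have hc := hD.concaveOn.2 (Set.mem_Ici.2 hk0) (Set.mem_Ici.2 (hk0.trans hlt.le))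
        (div_nonneg (sub_nonneg.2 (hk1 hlast)) hvu.le) (div_nonneg (sub_nonneg.2 hkx) hvu.le)
        (by field_simp; ring)
      have hx' : ((v - x) / (v - u)) • u + ((x - u) / (v - u)) • v = x := by
        simp only [smul_eq_mul]
        field_simp
        ring
      rw [hx', hend] at hc
      refine le_trans (le_of_eq ?_) hc
      simp only [halfLine, smul_eq_mul]
      field_simp
      ring
    · refine hD.halfLine_le_of_forall_ne hk0 (fun z hz hz' => hlast ((hN (k + 1)).2 ?_)) hkx
      intro j hj
      rcases Nat.lt_succ_iff_lt_or_eq.1 hj with hj | rfl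
      · exact (hN k).1 hkN j hj
      · exact ⟨z, hz, hz'⟩
  · have := hD.le_rightDeriv_tangent hk0 hkx
    simp only [halfLine]
    linarith

end IsConcaveDelay

/-! ### Piecewise linear delay functions -/

namespace PiecewiseLinearDelay

variable (f : PiecewiseLinearDelay)

/-- The line that extends piece `k`. -/
def tangent (k : ℕ) (t : ℝ) : ℝ := f.toFun (f.brk k) + f.slope k * (t - f.brk k)

variable {f}

lemma lt_pieces_of_le {j k : ℕ} (hk : (k : ℕ∞) < f.pieces) (hjk : j ≤ k) : (j : ℕ∞) < f.pieces :=
  lt_of_le_of_lt (Nat.cast_le.2 hjk) hk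

lemma HasNext.lt_pieces {k : ℕ} (h : f.HasNext k) : (k : ℕ∞) < f.pieces :=
  lt_pieces_of_le h (Nat.le_succ k)

lemma HasNext.brk_lt {k : ℕ} (h : f.HasNext k) : f.brk k < f.brk (k + 1) := f.brk_lt k h

lemma hasNext_of_lt {j k : ℕ} (hk : (k : ℕ∞) < f.pieces) (hjk : j < k) : f.HasNext j :=
  lt_pieces_of_le hk hjk

lemma brk_mono {j k : ℕ} (hk : (k : ℕ∞) < f.pieces) (hjk : j ≤ k) : f.brk j ≤ f.brk k := by
  induction k, hjk using Nat.le_induction with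
  | base => exact le_rfl
  | succ k hjk ih =>
    exact (ih (lt_pieces_of_le hk (Nat.le_succ k))).trans (f.brk_lt k hk).le

lemma brk_nonneg {k : ℕ} (hk : (k : ℕ∞) < f.pieces) : 0 ≤ f.brk k := by
  simpa [f.brk_zero] using brk_mono hk (Nat.zero_le k)

lemma HasNext.brk_succ_pos {k : ℕ} (h : f.HasNext k) : 0 < f.brk (k + 1) :=
  (brk_nonneg h.lt_pieces).trans_lt h.brk_lt

lemma slope_anti {j k : ℕ} (hk : (k : ℕ∞) < f.pieces) (hjk : j ≤ k) :
    f.slope k ≤ f.slope j := by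
  induction k, hjk using Nat.le_induction with
  | base => exact le_rfl
  | succ k hjk ih =>
    have := ih (lt_pieces_of_le hk (Nat.le_succ k))
    linarith [f.slope_halving k hk, f.slope_pos _ hk]

lemma HasNext.toFun_brk_succ {k : ℕ} (h : f.HasNext k) :
    f.toFun (f.brk (k + 1)) = f.tangent k (f.brk (k + 1)) :=
  f.linear k _ h.lt_pieces h.brk_lt.le fun _ => le_rfl

lemma HasNext.capacity_eq {k : ℕ} (h : f.HasNext k) :
    f.capacity k = f.slope k * (f.brk (k + 1) - f.brk k) := by
  rw [capacity, h.toFun_brk_succ, tangent]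
  ring

lemma HasNext.capacity_pos {k : ℕ} (h : f.HasNext k) : 0 < f.capacity k := by
  rw [h.capacity_eq]
  exact mul_pos (f.slope_pos k h.lt_pieces) (sub_pos.2 h.brk_lt)

/-- Every nonnegative number lies on a piece. -/
lemma exists_piece (f : PiecewiseLinearDelay) {x : ℝ} (hx : 0 ≤ x) :
    ∃ k : ℕ, (k : ℕ∞) < f.pieces ∧ f.brk k ≤ x ∧ (f.HasNext k → x < f.brk (k + 1)) := by
  have hex : ∃ k, f.HasNext k → x < f.brk (k + 1) := by
    by_contra! hcon
    have htop : f.pieces = ⊤ := by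
      refine ENat.eq_top_iff_forall_gt.2 fun n => ?_
      exact (hcon n).1.lt_pieces
    obtain ⟨k, hk⟩ := ((tendsto_add_atTop_nat 1).eventually
      ((f.brk_tendsto htop).eventually_gt_atTop x)).exists
    exact absurd (hcon k).2 (not_le.2 hk)
  classical
  refine ⟨Nat.find hex, ?_, ?_, Nat.find_spec hex⟩
  all_goals
    rcases hfind : Nat.find hex with _ | j
    · first | simpa using f.pieces_pos | simpa [f.brk_zero] using hx
    · have := Nat.find_min hex (m := j) (by omega)
      push Not at this
      first | exact this.1 | exact this.2

lemma tangent_succ_sub {k : ℕ} (h : f.HasNext k) (t : ℝ) :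
    f.tangent (k + 1) t - f.tangent k t =
      (f.slope (k + 1) - f.slope k) * (t - f.brk (k + 1)) := by
  have := h.toFun_brk_succ
  simp only [tangent] at this ⊢
  rw [this]
  ring

/-- The function lies below the lines that extend its pieces, because the slopes decrease. -/
lemma toFun_le_tangent {k : ℕ} (hk : (k : ℕ∞) < f.pieces) {x : ℝ} (hx : 0 ≤ x) :
    f.toFun x ≤ f.tangent k x := by
  obtain ⟨j, hj, hjx, hxj⟩ := f.exists_piece hx
  have hfx : f.toFun x = f.tangent j x := f.linear j x hj hjx fun h => (hxj h).le
  rw [hfx]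
  have hsl : ∀ i, f.HasNext i → f.slope (i + 1) - f.slope i ≤ 0 := fun i hi =>
    sub_nonpos.2 (slope_anti hi (Nat.le_succ i))
  rcases le_total k j with hkj | hjk
  · have : ∀ i, k ≤ i → i ≤ j → f.tangent i x ≤ f.tangent k x := by
      intro i hki
      induction i, hki using Nat.le_induction with
      | base => exact fun _ => le_rfl
      | succ i hki ih =>
        intro hij
        have hi : f.HasNext i := hasNext_of_lt hj hij
        have hb := brk_mono hj hij
        have h1 := tangent_succ_sub hi x
        have h2 := mul_nonpos_of_nonpos_of_nonneg (hsl i hi) (sub_nonneg.2 (hb.trans hjx))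
        linarith [ih (by omega)]
    exact this j hkj le_rfl
  · have : ∀ i, j ≤ i → i ≤ k → f.tangent j x ≤ f.tangent i x := by
      intro i hji
      induction i, hji using Nat.le_induction with
      | base => exact fun _ => le_rfl
      | succ i hji ih =>
        intro hik
        have hi : f.HasNext i := hasNext_of_lt hk hik
        have hjn : f.HasNext j := hasNext_of_lt hk (by omega)
        have hb : f.brk (j + 1) ≤ f.brk (i + 1) :=
          brk_mono (lt_pieces_of_le hk hik) (by omega)
        have h1 := tangent_succ_sub hi x
        have h2 := mul_nonneg_of_nonpos_of_nonpos (hsl i hi)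
          (sub_nonpos.2 ((hxj hjn).le.trans hb))
        linarith [ih (by omega)]
    exact this k hjk le_rfl

lemma monotoneOn (f : PiecewiseLinearDelay) : MonotoneOn f.toFun (Set.Ici 0) := by
  intro x hx y hy hxy
  obtain ⟨j, hj, hjy, hyj⟩ := f.exists_piece (Set.mem_Ici.1 hy)
  have h1 := toFun_le_tangent hj (Set.mem_Ici.1 hx)
  rw [f.linear j y hj hjy fun h => (hyj h).le]
  refine h1.trans ?_
  have := f.slope_pos j hj
  unfold tangent
  gcongr

lemma toFun_nonneg (f : PiecewiseLinearDelay) {x : ℝ} (hx : 0 ≤ x) : 0 ≤ f.toFun x := by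
  simpa [f.map_zero] using f.monotoneOn (Set.mem_Ici.2 le_rfl) (Set.mem_Ici.2 hx) hx

/-- Piece `k` does not end at or before `x`. -/
def Unfinished (f : PiecewiseLinearDelay) (k : ℕ) (x : ℝ) : Prop := f.HasNext k → x < f.brk (k + 1)

lemma Unfinished.of_le {k : ℕ} {x y : ℝ} (h : f.Unfinished k y) (hxy : x ≤ y) :
    f.Unfinished k x := fun hk => hxy.trans_lt (h hk)

lemma hasNext_of_not_unfinished {k : ℕ} {x : ℝ} (h : ¬ f.Unfinished k x) : f.HasNext k := by
  by_contra hk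
  exact h fun h' => absurd h' hk

open Classical in
/-- The sum of the capacities of the pieces with index below `N` that end at or before `x`. -/
noncomputable def finishedCapacity (f : PiecewiseLinearDelay) (N : ℕ) (x : ℝ) : ℝ :=
  ∑ k ∈ Finset.range N, if f.Unfinished k x then 0 else f.capacity k

lemma finishedCapacity_le (f : PiecewiseLinearDelay) (N : ℕ) {x : ℝ} (hx : 0 ≤ x) :
    f.finishedCapacity N x ≤ f.toFun x := by
  classical
  obtain ⟨j, hj, hjx, hxj⟩ := f.exists_piece hx
  have hswap : f.finishedCapacity N x =
      ∑ k ∈ Finset.range N, if ¬ f.Unfinished k x then f.capacity k else 0 := by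
    simp [finishedCapacity, ite_not]
  rw [hswap, ← Finset.sum_filter]
  have hsub : (Finset.range N).filter (fun k => ¬ f.Unfinished k x) ⊆ Finset.range j := by
    intro k hk
    obtain ⟨-, hk⟩ := Finset.mem_filter.1 hk
    have hk1 := hasNext_of_not_unfinished hk
    have hk2 : f.brk (k + 1) ≤ x := not_lt.1 fun h => hk fun _ => h
    rw [Finset.mem_range]
    by_contra! hjk
    have hjn : f.HasNext j := lt_pieces_of_le hk1 (Nat.succ_le_succ hjk)
    exact absurd ((brk_mono hk1 (Nat.succ_le_succ hjk)).trans hk2) (not_le.2 (hxj hjn))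
  refine (Finset.sum_le_sum_of_subset_of_nonneg hsub fun k hk _ => ?_).trans ?_
  · exact (hasNext_of_lt hj (Finset.mem_range.1 hk)).capacity_pos.le
  · simp only [capacity]
    rw [Finset.sum_range_sub (fun k => f.toFun (f.brk k)), f.brk_zero, f.map_zero, sub_zero]
    exact f.monotoneOn (Set.mem_Ici.2 (brk_nonneg hj)) (Set.mem_Ici.2 hx) hjx

/-- The slopes of consecutive pieces form a series dominated by a geometric one. -/
lemma sum_slope_le (f : PiecewiseLinearDelay) {j N : ℕ} (hjN : j < N) (hN : (N : ℕ∞) ≤ f.pieces) :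
    ∑ k ∈ Finset.Ico j N, f.slope k ≤ 2 * f.slope j := by
  suffices h : ∀ m, j < m → (m : ℕ∞) ≤ f.pieces →
      ∑ k ∈ Finset.Ico j m, f.slope k + f.slope (m - 1) ≤ 2 * f.slope j by
    have h1 := h N hjN hN
    have h2 := f.slope_pos (N - 1)
      (lt_of_lt_of_le (Nat.cast_lt.2 (by omega : N - 1 < N)) hN)
    linarith
  intro m hm
  induction m, hm using Nat.le_induction with
  | base => intro _; simp [two_mul]
  | succ m hm ih =>
    intro hmN
    obtain ⟨i, rfl⟩ : ∃ i, m = i + 1 := ⟨m - 1, by omega⟩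
    have hlt : ((i + 1 : ℕ) : ℕ∞) < f.pieces :=
      lt_of_lt_of_le (Nat.cast_lt.2 (Nat.lt_succ_self _)) hmN
    have := ih hlt.le
    rw [Finset.sum_Ico_succ_top (by omega)]
    have h2 := f.slope_halving i hlt
    simp only [Nat.add_sub_cancel] at this ⊢
    linarith

open Classical in
/-- While the argument runs from `x` to `y` without passing the end of a piece that is unfinished at
`x`, the delay grows at a rate of at least half the sum of the slopes of the pieces unfinished at
`x`. -/
lemma mul_sum_slope_le (f : PiecewiseLinearDelay) {N : ℕ} (hN : (N : ℕ∞) ≤ f.pieces) {x y : ℝ}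
    (hx : 0 ≤ x) (hxy : x ≤ y)
    (hno : ∀ k < N, f.HasNext k → x < f.brk (k + 1) → y ≤ f.brk (k + 1)) :
    (y - x) * ∑ k ∈ Finset.range N, (if f.Unfinished k x then f.slope k else 0) ≤
      2 * (f.toFun y - f.toFun x) := by
  obtain ⟨j, hj, hjx, hxj⟩ := f.exists_piece hx
  have hlow : ∀ k < j, ¬ f.Unfinished k x := fun k hk h =>
    absurd ((brk_mono hj hk).trans hjx) (not_le.2 (h (hasNext_of_lt hj hk)))
  have hmono := f.monotoneOn (Set.mem_Ici.2 hx) (Set.mem_Ici.2 (hx.trans hxy)) hxy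
  rcases le_or_gt N j with hNj | hjN
  · rw [Finset.sum_eq_zero, mul_zero]
    · linarith
    · intro k hk
      rw [if_neg (hlow k ((Finset.mem_range.1 hk).trans_le hNj))]
  · have hy : f.toFun y - f.toFun x = f.slope j * (y - x) := by
      rw [f.linear j y hj (hjx.trans hxy) fun h => hno j hjN h (hxj h),
        f.linear j x hj hjx fun h => (hxj h).le]
      ring
    rw [hy, ← Finset.sum_range_add_sum_Ico _ hjN.le, Finset.sum_eq_zero (s := Finset.range j)
      fun k hk => if_neg (hlow k (Finset.mem_range.1 hk)), zero_add]
    have h1 : ∑ k ∈ Finset.Ico j N, (if f.Unfinished k x then f.slope k else 0) ≤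
        ∑ k ∈ Finset.Ico j N, f.slope k := by
      refine Finset.sum_le_sum fun k hk => ?_
      have := f.slope_pos k (lt_of_lt_of_le (Nat.cast_lt.2 (Finset.mem_Ico.1 hk).2) hN)
      split_ifs
      · exact le_rfl
      · exact this.le
    have h2 := h1.trans (f.sum_slope_le hjN hN)
    nlinarith [mul_le_mul_of_nonneg_left h2 (sub_nonneg.2 hxy)]

end PiecewiseLinearDelay

/-! ### Surpluses as sums over requests -/

lemma sgn_not (b : Bool) : sgn (!b) = -sgn b := by cases b <;> simp [sgn]

lemma sgn_eq_neg_of_ne {b b' : Bool} (h : b ≠ b') : sgn b = -sgn b' := by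
  cases b <;> cases b' <;> simp_all [sgn]

lemma abs_sgn (b : Bool) : |sgn b| = 1 := by cases b <;> simp [sgn]

lemma sgn_mul_self (b : Bool) : sgn b * sgn b = 1 := by cases b <;> simp [sgn]

/-- The contribution of a request of sign `s` to the surplus of level `k`. -/
def Status.surAt {ι : Type*} (k : ℕ) (s : ℤ) : Status ι → ℤ
  | .waiting j => if j ≤ k then s else 0
  | _ => 0

/-- The contribution of a request of sign `s` to the surplus of all arrived requests. -/
def Status.arrivedAt {ι : Type*} (s : ℤ) : Status ι → ℤ
  | .future => 0
  | _ => s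

variable {ι : Type*} [Fintype ι]

lemma sum_update [DecidableEq ι] {M : Type*} [AddCommGroup M] (g : ι → Status ι → M)
    (st : ι → Status ι) (r : ι) (v : Status ι) :
    ∑ x, g x (Function.update st r v x) = ∑ x, g x (st x) + (g r v - g r (st r)) := by
  rw [← sub_eq_iff_eq_add', ← Finset.sum_sub_distrib, Finset.sum_eq_single r]
  · simp
  · intro x _ hx
    simp [Function.update_of_ne hx]
  · simp

namespace Config

variable {I : Input ι} {c : Config ι}

lemma count_pos_iff {k : ℕ} {b : Bool} :
    0 < c.count I k b ↔ ∃ r, I.polarity r = b ∧ c.status r = .waiting k := by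
  classical
  simp [count, Finset.card_pos, Finset.filter_nonempty_iff]

open Classical in
lemma count_sub_count (I : Input ι) (c : Config ι) (k : ℕ) :
    (c.count I k true : ℤ) - c.count I k false =
      ∑ r, if c.status r = .waiting k then sgn (I.polarity r) else 0 := by
  simp only [count, Finset.card_filter, Nat.cast_sum]
  rw [← Finset.sum_sub_distrib]
  refine Finset.sum_congr rfl fun r _ => ?_
  by_cases h : c.status r = .waiting k <;> cases I.polarity r <;> simp [h, sgn]

lemma sur_eq_sum (I : Input ι) (c : Config ι) (k : ℕ) :
    c.sur I k = ∑ r, (c.status r).surAt k (sgn (I.polarity r)) := by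
  classical
  simp only [sur, count_sub_count]
  rw [Finset.sum_comm]
  refine Finset.sum_congr rfl fun r _ => ?_
  rcases hst : c.status r with _ | j | ⟨s, m⟩
  · simp [Status.surAt]
  · simp [Status.surAt, Finset.sum_ite_eq]
  · simp [Status.surAt]

lemma sur_succ (I : Input ι) (c : Config ι) (k : ℕ) :
    c.sur I (k + 1) =
      c.sur I k + ((c.count I (k + 1) true : ℤ) - c.count I (k + 1) false) := by
  simp only [sur]
  rw [Finset.sum_range_succ]

lemma abs_sur_le (I : Input ι) (c : Config ι) (k : ℕ) : |c.sur I k| ≤ Fintype.card ι := by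
  rw [sur_eq_sum]
  refine (Finset.abs_sum_le_sum_abs _ _).trans ?_
  refine (Finset.sum_le_card_nsmul _ _ 1 fun r _ => ?_).trans (by simp)
  rcases c.status r with _ | j | ⟨s, m⟩
  · simp [Status.surAt]
  · simp only [Status.surAt]
    split_ifs
    · exact (abs_sgn _).le
    · simp
  · simp [Status.surAt]

/-- The configuration after waiting for a time `δ` in which no event occurs. -/
noncomputable def advance (f : PiecewiseLinearDelay) (I : Input ι) (c : Config ι) (δ : ℝ) :
    Config ι :=
  { c with
    time := c.time + δ
    counter := fun k b => c.counter k b + δ * c.rate f I k b }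

lemma rate_nonneg (f : PiecewiseLinearDelay) (I : Input ι) (c : Config ι) {k : ℕ}
    (hk : (k : ℕ∞) < f.pieces) (b : Bool) : 0 ≤ c.rate f I k b := by
  rw [rate]
  split_ifs
  · exact mul_nonneg (f.slope_pos k hk).le (abs_nonneg _)
  · exact le_rfl

lemma rate_le (f : PiecewiseLinearDelay) (I : Input ι) (c : Config ι) {k : ℕ}
    (hk : (k : ℕ∞) < f.pieces) (b : Bool) :
    c.rate f I k b ≤ f.slope k * Fintype.card ι := by
  have hs := (f.slope_pos k hk).le
  rw [rate]
  split_ifs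
  · gcongr
    exact_mod_cast c.abs_sur_le I k
  · positivity

end Config

lemma Input.sum_sgn (I : Input ι) : ∑ r, sgn (I.polarity r) = 0 := by
  have h : ∀ r, sgn (I.polarity r) =
      (if I.polarity r = true then 1 else 0) - (if I.polarity r = false then 1 else 0) := by
    intro r
    cases I.polarity r <;> simp [sgn]
  simp only [h]
  rw [Finset.sum_sub_distrib, Finset.sum_boole, Finset.sum_boole, I.balanced]
  simp

/-! ### Invariants of the runs -/

/-- Invariants of the reachable configurations. The time needed to fill a counter of level `k` is at
least the length of piece `k` divided by the number of requests; therefore a request can be on level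
`k` only if `f.brk k` is at most the number of requests times the current time. -/
structure Valid (f : PiecewiseLinearDelay) (I : Input ι) (c : Config ι) : Prop where
  time_nonneg : 0 ≤ c.time
  time_le_arrival : ∀ r, c.status r = .future → c.time ≤ I.arrival r
  arrival_le_time : ∀ r, c.status r ≠ .future → I.arrival r ≤ c.time
  matched : ∀ r s m, c.status r = .matched s m →
    c.status s = .matched r m ∧ I.polarity s ≠ I.polarity r ∧ I.arrival r ≤ m
  lt_pieces : ∀ r k, c.status r = .waiting k → (k : ℕ∞) < f.pieces
  brk_le_time : ∀ r k, c.status r = .waiting k → f.brk k ≤ Fintype.card ι * c.time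
  brk_le_arrival : ∀ r k, c.status r = .waiting k →
    ∃ a, f.brk k ≤ Fintype.card ι * I.arrival a
  counter_nonneg : ∀ k b, 0 ≤ c.counter k b
  counter_le : ∀ k b, f.HasNext k → c.counter k b ≤ f.capacity k
  counter_le_time : ∀ (k : ℕ) (b : Bool), (k : ℕ∞) < f.pieces → 0 < c.counter k b →
    c.counter k b ≤ f.slope k * (Fintype.card ι * c.time - f.brk k)

namespace Valid

variable {f : PiecewiseLinearDelay} {I : Input ι} {c : Config ι}

/-- If all waiting requests are on levels up to `k`, then the surplus of level `k` is the surplus of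
all requests that have arrived, since matched pairs do not contribute to the latter. -/
lemma sur_eq_arrived (h : Valid f I c) {k : ℕ}
    (hk : ∀ r j, c.status r = .waiting j → j ≤ k) :
    c.sur I k = ∑ r, (c.status r).arrivedAt (sgn (I.polarity r)) := by
  classical
  rw [Config.sur_eq_sum, eq_comm, ← sub_eq_zero, ← Finset.sum_sub_distrib]
  let p : ι → ι := fun r => match c.status r with
    | .matched s _ => s
    | _ => r
  have hp : ∀ r s m, c.status r = .matched s m → p r = s := by
    intro r s m hr
    simp only [p, hr]
  refine Finset.sum_involution (fun r _ => p r) ?_ ?_ (fun _ _ => Finset.mem_univ _) ?_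
  · intro r _
    rcases hr : c.status r with _ | j | ⟨s, m⟩
    · have : p r = r := by simp only [p, hr]
      simp [this, hr, Status.arrivedAt, Status.surAt]
    · have : p r = r := by simp only [p, hr]
      simp [this, hr, Status.arrivedAt, Status.surAt, hk r j hr]
    · obtain ⟨hs, hne, -⟩ := h.matched r s m hr
      rw [hp r s m hr, hs]
      simp [Status.arrivedAt, Status.surAt, sgn_eq_neg_of_ne hne]
  · intro r _ hr0 hpr
    rcases hr : c.status r with _ | j | ⟨s, m⟩
    · simp [hr, Status.arrivedAt, Status.surAt] at hr0
    · simp [hr, Status.arrivedAt, Status.surAt, hk r j hr] at hr0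
    · obtain ⟨-, hne, -⟩ := h.matched r s m hr
      rw [hp r s m hr] at hpr
      exact hne (by rw [hpr])
  · intro r _
    rcases hr : c.status r with _ | j | ⟨s, m⟩
    · have : p r = r := by simp only [p, hr]
      simp [this]
    · have : p r = r := by simp only [p, hr]
      simp [this]
    · rw [hp r s m hr, hp s r m (h.matched r s m hr).1]

/-- Once all requests have arrived, the surplus of the highest occupied level vanishes. -/
lemma sur_eq_zero (h : Valid f I c) {k : ℕ} (hk : ∀ r j, c.status r = .waiting j → j ≤ k)
    (hfut : ∀ r, c.status r ≠ .future) : c.sur I k = 0 := by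
  rw [h.sur_eq_arrived hk, ← I.sum_sgn]
  refine Finset.sum_congr rfl fun r _ => ?_
  have := hfut r
  rcases hr : c.status r with _ | j | ⟨s, m⟩
  · exact absurd hr this
  · rfl
  · rfl

variable (f I) in
lemma init : Valid f I (Config.init ι) where
  time_nonneg := le_rfl
  time_le_arrival r _ := I.arrival_nonneg r
  arrival_le_time r hr := absurd rfl hr
  matched r s m hr := by cases hr
  lt_pieces r k hr := by cases hr
  brk_le_time r k hr := by cases hr
  brk_le_arrival r k hr := by cases hr
  counter_nonneg k b := le_rfl
  counter_le k b hk := hk.capacity_pos.le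
  counter_le_time k b _ h0 := absurd h0 (lt_irrefl _)

lemma advance (h : Valid f I c) {δ : ℝ} (hδ : 0 ≤ δ)
    (hfut : ∀ r, c.status r = .future → c.time + δ ≤ I.arrival r)
    (hcap : ∀ k b, c.Active I k b → f.HasNext k →
      c.counter k b + δ * c.rate f I k b ≤ f.capacity k) :
    Valid f I (c.advance f I δ) where
  time_nonneg := add_nonneg h.time_nonneg hδ
  time_le_arrival := hfut
  arrival_le_time r hr := (h.arrival_le_time r hr).trans (le_add_of_nonneg_right hδ)
  matched := h.matched
  lt_pieces := h.lt_pieces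
  brk_le_time r k hr := (h.brk_le_time r k hr).trans (by
    change _ ≤ (Fintype.card ι : ℝ) * (c.time + δ)
    gcongr
    linarith)
  brk_le_arrival := h.brk_le_arrival
  counter_nonneg k b := by
    change 0 ≤ c.counter k b + δ * c.rate f I k b
    by_cases hact : c.Active I k b
    · obtain ⟨r, -, hr⟩ := Config.count_pos_iff.1 hact.1
      exact add_nonneg (h.counter_nonneg k b)
        (mul_nonneg hδ (c.rate_nonneg f I (h.lt_pieces r k hr) b))
    · rw [Config.rate, if_neg hact, mul_zero, add_zero]
      exact h.counter_nonneg k b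
  counter_le k b hk := by
    change c.counter k b + δ * c.rate f I k b ≤ _
    by_cases hact : c.Active I k b
    · exact hcap k b hact hk
    · rw [Config.rate, if_neg hact, mul_zero, add_zero]
      exact h.counter_le k b hk
  counter_le_time k b hk := by
    change 0 < c.counter k b + δ * c.rate f I k b → c.counter k b + δ * c.rate f I k b ≤
      f.slope k * (Fintype.card ι * (c.time + δ) - f.brk k)
    intro hpos
    have hs := (f.slope_pos k hk).le
    by_cases hact : c.Active I k b
    · obtain ⟨r, -, hr⟩ := Config.count_pos_iff.1 hact.1
      have h1 := mul_le_mul_of_nonneg_left (c.rate_le f I hk b) hδ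
      have h2 := mul_nonneg hs (sub_nonneg.2 (h.brk_le_time r k hr))
      have h3 : c.counter k b ≤ f.slope k * (Fintype.card ι * c.time - f.brk k) := by
        rcases (h.counter_nonneg k b).eq_or_lt with h0 | h0
        · rw [← h0]
          exact h2
        · exact h.counter_le_time k b hk h0
      linarith
    · rw [Config.rate, if_neg hact, mul_zero, add_zero] at hpos ⊢
      refine (h.counter_le_time k b hk hpos).trans ?_
      gcongr
      linarith

/-- The breakpoint of a level to which a request moves up obeys the bounds for occupied levels:
either an arrival is still to come, and the current time is at most the time of that arrival, or the
level is at most the highest occupied one. -/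
lemma brk_succ_le_arrival (h : Valid f I c) {k : ℕ} {b : Bool} (hk : f.HasNext k)
    (hact : c.Active I k b) (hfull : c.counter k b = f.capacity k) :
    f.brk (k + 1) ≤ Fintype.card ι * c.time ∧
      ∃ a, f.brk (k + 1) ≤ Fintype.card ι * I.arrival a := by
  have h1 : f.brk (k + 1) ≤ Fintype.card ι * c.time := by
    have hc := h.counter_le_time k b hk.lt_pieces (hfull ▸ hk.capacity_pos)
    rw [hfull, hk.capacity_eq] at hc
    have := le_of_mul_le_mul_left hc (f.slope_pos k hk.lt_pieces)
    linarith
  refine ⟨h1, ?_⟩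
  by_cases hfut : ∃ a, c.status a = .future
  · obtain ⟨a, ha⟩ := hfut
    refine ⟨a, h1.trans ?_⟩
    gcongr
    exact h.time_le_arrival a ha
  · push Not at hfut
    by_cases hhigh : ∀ r j, c.status r = .waiting j → j ≤ k
    · have h0 := hact.2
      rw [h.sur_eq_zero hhigh hfut, mul_zero] at h0
      exact absurd h0 (lt_irrefl _)
    · push Not at hhigh
      obtain ⟨r, j, hr, hkj⟩ := hhigh
      obtain ⟨a, ha⟩ := h.brk_le_arrival r j hr
      exact ⟨a, (PiecewiseLinearDelay.brk_mono (h.lt_pieces r j hr) hkj).trans ha⟩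

lemma step [DecidableEq ι] (h : Valid f I c) {c' : Config ι} (hstep : Step f I c c') :
    Valid f I c' := by
  cases hstep with
  | arrive r hr ht =>
    have key : ∀ x v, Function.update c.status r (.waiting 0) x = v →
        (x = r ∧ v = .waiting 0) ∨ (x ≠ r ∧ c.status x = v) := by
      intro x v hx
      by_cases hxr : x = r
      · subst hxr
        exact Or.inl ⟨rfl, by simpa using hx.symm⟩
      · exact Or.inr ⟨hxr, by simpa [hxr] using hx⟩
    refine ⟨h.time_nonneg, ?_, ?_, ?_, ?_, ?_, ?_, h.counter_nonneg, h.counter_le,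
      h.counter_le_time⟩
    · intro x hx
      rcases key x _ hx with ⟨-, hv⟩ | ⟨-, hx'⟩
      · cases hv
      · exact h.time_le_arrival x hx'
    · intro x hx
      by_cases hxr : x = r
      · subst hxr
        exact ht.le
      · exact h.arrival_le_time x (by simpa [hxr] using hx)
    · intro x s m hx
      rcases key x _ hx with ⟨-, hv⟩ | ⟨hxr, hx'⟩
      · cases hv
      · obtain ⟨h1, h2⟩ := h.matched x s m hx'
        refine ⟨?_, h2⟩
        have hsr : s ≠ r := by
          rintro rfl
          rw [hr] at h1
          cases h1
        simpa [hsr] using h1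
    · intro x k hx
      rcases key x _ hx with ⟨-, hv⟩ | ⟨-, hx'⟩
      · cases hv
        simpa using f.pieces_pos
      · exact h.lt_pieces x k hx'
    · intro x k hx
      rcases key x _ hx with ⟨-, hv⟩ | ⟨-, hx'⟩
      · cases hv
        rw [f.brk_zero]
        exact mul_nonneg (Nat.cast_nonneg _) h.time_nonneg
      · exact h.brk_le_time x k hx'
    · intro x k hx
      rcases key x _ hx with ⟨-, hv⟩ | ⟨-, hx'⟩
      · cases hv
        refine ⟨r, ?_⟩
        rw [f.brk_zero]
        exact mul_nonneg (Nat.cast_nonneg _) (I.arrival_nonneg r)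
      · exact h.brk_le_arrival x k hx'
  | pair k r s hr hs hrk hsk =>
    have hrs : r ≠ s := by
      rintro rfl
      rw [hr] at hs
      cases hs
    have key : ∀ x v, Function.update (Function.update c.status r (.matched s c.time)) s
        (.matched r c.time) x = v → (x = r ∧ v = .matched s c.time) ∨
          (x = s ∧ v = .matched r c.time) ∨ (x ≠ r ∧ x ≠ s ∧ c.status x = v) := by
      intro x v hx
      by_cases hxs : x = s
      · subst hxs
        exact Or.inr (Or.inl ⟨rfl, by simpa using hx.symm⟩)
      · by_cases hxr : x = r
        · subst hxr
          exact Or.inl ⟨rfl, by simpa [hxs] using hx.symm⟩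
        · exact Or.inr (Or.inr ⟨hxr, hxs, by simpa [hxs, hxr] using hx⟩)
    refine ⟨h.time_nonneg, ?_, ?_, ?_, ?_, ?_, ?_, h.counter_nonneg, h.counter_le,
      h.counter_le_time⟩
    · intro x hx
      rcases key x _ hx with ⟨-, hv⟩ | ⟨-, hv⟩ | ⟨-, -, hx'⟩
      · cases hv
      · cases hv
      · exact h.time_le_arrival x hx'
    · intro x hx
      by_cases hxr : x = r
      · subst hxr
        exact h.arrival_le_time x (by simp [hrk])
      · by_cases hxs : x = s
        · subst hxs
          exact h.arrival_le_time x (by simp [hsk])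
        · exact h.arrival_le_time x (by simpa [hxs, hxr] using hx)
    · intro x y m hx
      rcases key x _ hx with ⟨rfl, hv⟩ | ⟨rfl, hv⟩ | ⟨hxr, hxs, hx'⟩
      · cases hv
        refine ⟨by simp, by simp [hr, hs], h.arrival_le_time x (by simp [hrk])⟩
      · cases hv
        refine ⟨by simp [hrs], by simp [hr, hs], h.arrival_le_time x (by simp [hsk])⟩
      · obtain ⟨h1, h2⟩ := h.matched x y m hx'
        have hyr : y ≠ r := by
          rintro rfl
          rw [hrk] at h1
          cases h1
        have hys : y ≠ s := by
          rintro rfl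
          rw [hsk] at h1
          cases h1
        exact ⟨by simpa [hyr, hys] using h1, h2⟩
    · intro x j hx
      rcases key x _ hx with ⟨-, hv⟩ | ⟨-, hv⟩ | ⟨-, -, hx'⟩
      · cases hv
      · cases hv
      · exact h.lt_pieces x j hx'
    · intro x j hx
      rcases key x _ hx with ⟨-, hv⟩ | ⟨-, hv⟩ | ⟨-, -, hx'⟩
      · cases hv
      · cases hv
      · exact h.brk_le_time x j hx'
    · intro x j hx
      rcases key x _ hx with ⟨-, hv⟩ | ⟨-, hv⟩ | ⟨-, -, hx'⟩
      · cases hv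
      · cases hv
      · exact h.brk_le_arrival x j hx'
  | move k b r hpair hk hact hfull hr hrk =>
    have key : ∀ x v, Function.update c.status r (.waiting (k + 1)) x = v →
        (x = r ∧ v = .waiting (k + 1)) ∨ (x ≠ r ∧ c.status x = v) := by
      intro x v hx
      by_cases hxr : x = r
      · subst hxr
        exact Or.inl ⟨rfl, by simpa using hx.symm⟩
      · exact Or.inr ⟨hxr, by simpa [hxr] using hx⟩
    obtain ⟨hb1, hb2⟩ := h.brk_succ_le_arrival hk hact hfull
    refine ⟨h.time_nonneg, ?_, ?_, ?_, ?_, ?_, ?_, ?_, ?_, ?_⟩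
    · intro x hx
      rcases key x _ hx with ⟨-, hv⟩ | ⟨-, hx'⟩
      · cases hv
      · exact h.time_le_arrival x hx'
    · intro x hx
      by_cases hxr : x = r
      · subst hxr
        exact h.arrival_le_time x (by simp [hrk])
      · exact h.arrival_le_time x (by simpa [hxr] using hx)
    · intro x s m hx
      rcases key x _ hx with ⟨-, hv⟩ | ⟨hxr, hx'⟩
      · cases hv
      · obtain ⟨h1, h2⟩ := h.matched x s m hx'
        refine ⟨?_, h2⟩
        have hsr : s ≠ r := by
          rintro rfl
          rw [hrk] at h1
          cases h1
        simpa [hsr] using h1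
    · intro x j hx
      rcases key x _ hx with ⟨-, hv⟩ | ⟨-, hx'⟩
      · cases hv
        exact hk
      · exact h.lt_pieces x j hx'
    · intro x j hx
      rcases key x _ hx with ⟨-, hv⟩ | ⟨-, hx'⟩
      · cases hv
        exact hb1
      · exact h.brk_le_time x j hx'
    · intro x j hx
      rcases key x _ hx with ⟨-, hv⟩ | ⟨-, hx'⟩
      · cases hv
        exact hb2
      · exact h.brk_le_arrival x j hx'
    · intro j b'
      by_cases hj : j = k
      · subst hj
        simp
      · simpa [hj] using h.counter_nonneg j b'
    · intro j b' hj'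
      by_cases hj : j = k
      · subst hj
        simpa using hj'.capacity_pos.le
      · simpa [hj] using h.counter_le j b' hj'
    · intro j b' hj'
      by_cases hj : j = k
      · subst hj
        simp
      · simpa [hj] using h.counter_le_time j b' hj'
  | wait δ hδ hpair hfut hcap hnext => exact h.advance hδ.le hfut hcap

end Valid

lemma Reachable.valid [DecidableEq ι] {f : PiecewiseLinearDelay} {I : Input ι} {c : Config ι}
    (h : Reachable f I c) : Valid f I c := by
  induction h with
  | refl => exact Valid.init f I
  | tail _ hstep ih => exact ih.step hstep

/-- The levels that can be reached are bounded: the breakpoints of the occupied levels are bounded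
by the number of requests times the last arrival time. -/
lemma exists_level_bound (f : PiecewiseLinearDelay) (I : Input ι) :
    ∃ N : ℕ, (N : ℕ∞) ≤ f.pieces ∧
      ∀ c, Valid f I c → ∀ r k, c.status r = .waiting k → k < N := by
  rcases eq_or_ne f.pieces ⊤ with htop | hfin
  · have hev : ∀ᶠ k in atTop, ∀ a, Fintype.card ι * I.arrival a < f.brk k :=
      eventually_all.2 fun a => (f.brk_tendsto htop).eventually_gt_atTop _
    obtain ⟨N, hN⟩ := eventually_atTop.1 hev
    refine ⟨N, htop ▸ le_top, fun c hc r k hr => ?_⟩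
    obtain ⟨a, ha⟩ := hc.brk_le_arrival r k hr
    by_contra! hNk
    exact absurd ha (not_le.2 (hN k hNk a))
  · obtain ⟨N, hN⟩ := ENat.ne_top_iff_exists.1 hfin
    refine ⟨N, hN.le, fun c hc r k hr => ?_⟩
    have := hc.lt_pieces r k hr
    rw [← hN] at this
    exact Nat.cast_lt.1 this

/-! ### Termination -/

/-- An event is due: a request arrives, or an active counter is full. -/
def Config.Due (f : PiecewiseLinearDelay) (I : Input ι) (c : Config ι) : Prop :=
  (∃ r, c.status r = .future ∧ c.time = I.arrival r) ∨
    ∃ k b, c.Active I k b ∧ f.HasNext k ∧ c.counter k b = f.capacity k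

/-- A bound for the number of arrivals, matchings and moves that a request can still take part in,
if all levels are below `N`. -/
def Status.weight (N : ℕ) : Status ι → ℕ
  | .future => N + 2
  | .waiting k => N + 1 - k
  | .matched _ _ => 0

open Classical in
/-- A quantity that decreases with every step; waiting is counted by the second summand, since
waiting ends only when an event is due. -/
noncomputable def Config.stepsLeft (f : PiecewiseLinearDelay) (I : Input ι) (N : ℕ)
    (c : Config ι) : ℕ :=
  2 * ∑ r, (c.status r).weight N + if c.Due f I then 0 else 1

lemma sum_weight_update [DecidableEq ι] (N : ℕ) (st : ι → Status ι) (r : ι) (v : Status ι) :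
    ∑ x, (Function.update st r v x).weight N + (st r).weight N =
      ∑ x, (st x).weight N + v.weight N := by
  have h := sum_update (fun _ s => ((Status.weight N s : ℕ) : ℤ)) st r v
  zify
  rw [h]
  ring

lemma Config.stepsLeft_lt (f : PiecewiseLinearDelay) (I : Input ι) (N : ℕ) {c c' : Config ι}
    (h : ∑ r, (c'.status r).weight N < ∑ r, (c.status r).weight N) :
    c'.stepsLeft f I N < c.stepsLeft f I N := by
  unfold Config.stepsLeft
  split_ifs <;> omega

lemma Step.stepsLeft_lt [DecidableEq ι] {f : PiecewiseLinearDelay} {I : Input ι} {N : ℕ}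
    {c c' : Config ι}
    (hlev : ∀ r k, c.status r = .waiting k → k < N) (hstep : Step f I c c') :
    c'.stepsLeft f I N < c.stepsLeft f I N := by
  cases hstep with
  | arrive r hr ht =>
    refine Config.stepsLeft_lt f I N ?_
    have := sum_weight_update N c.status r (.waiting 0)
    rw [hr] at this
    simp only [Status.weight] at this ⊢
    omega
  | pair k r s hr hs hrk hsk =>
    refine Config.stepsLeft_lt f I N ?_
    have hrs : s ≠ r := by
      rintro rfl
      rw [hr] at hs
      cases hs
    have h1 := sum_weight_update N c.status r (.matched s c.time)
    have h2 := sum_weight_update N (Function.update c.status r (.matched s c.time)) s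
      (.matched r c.time)
    rw [Function.update_of_ne hrs, hsk] at h2
    rw [hrk] at h1
    have := hlev r k hrk
    simp only [Status.weight] at h1 h2 ⊢
    omega
  | move k b r hpair hk hact hfull hr hrk =>
    refine Config.stepsLeft_lt f I N ?_
    have h1 := sum_weight_update N c.status r (.waiting (k + 1))
    rw [hrk] at h1
    have := hlev r k hrk
    simp only [Status.weight] at h1 ⊢
    omega
  | wait δ hδ hpair hfut hcap hnext =>
    have hnot : ¬ c.Due f I := by
      rintro (⟨r, hr, ht⟩ | ⟨k, b, hact, hk, hfull⟩)
      · linarith [hfut r hr]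
      · have h1 := hcap k b hact hk
        have h2 : 0 < c.rate f I k b := by
          rw [Config.rate, if_pos hact]
          refine mul_pos (f.slope_pos k hk.lt_pieces) (abs_pos.2 ?_)
          intro h0
          have h3 := hact.2
          rw [Int.cast_eq_zero.1 h0, mul_zero] at h3
          exact lt_irrefl _ h3
        nlinarith [mul_pos hδ h2]
    have hdue : (c.advance f I δ).Due f I := hnext
    change (c.advance f I δ).stepsLeft f I N < _
    rw [Config.stepsLeft, Config.stepsLeft, if_pos hdue, if_neg hnot]
    exact Nat.lt_succ_self _

theorem not_exists_infinite_run [DecidableEq ι] (f : PiecewiseLinearDelay) (I : Input ι) :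
    ¬ ∃ run : ℕ → Config ι, run 0 = Config.init ι ∧ ∀ n, Step f I (run n) (run (n + 1)) := by
  rintro ⟨run, h0, hrun⟩
  obtain ⟨N, -, hN⟩ := exists_level_bound f I
  have hvalid : ∀ n, Valid f I (run n) := by
    intro n
    induction n with
    | zero => exact h0 ▸ Valid.init f I
    | succ n ih => exact ih.step (hrun n)
  have hdec : ∀ n, (run n).stepsLeft f I N + n ≤ (run 0).stepsLeft f I N := by
    intro n
    induction n with
    | zero => simp
    | succ n ih =>
      have := (hrun n).stepsLeft_lt (hN _ (hvalid n))
      omega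
  have := hdec ((run 0).stepsLeft f I N + 1)
  omega

/-- If nothing can be matched, then the counter of the lowest occupied level is active. -/
lemma Config.exists_active {I : Input ι} {c : Config ι} (hpair : ¬ c.HasPair I)
    (hw : ∃ k r, c.status r = .waiting k) :
    ∃ k r, c.status r = .waiting k ∧ c.Active I k (I.polarity r) := by
  classical
  obtain ⟨r, hr⟩ := Nat.find_spec hw
  have hmin : ∀ j < Nat.find hw, ∀ s, c.status s ≠ .waiting j := fun j hj s hs =>
    Nat.find_min hw hj ⟨s, hs⟩
  generalize Nat.find hw = k at hr hmin
  refine ⟨k, r, hr, count_pos_iff.2 ⟨r, rfl, hr⟩, ?_⟩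
  have hpol : ∀ s, c.status s = .waiting k → I.polarity s = I.polarity r := by
    intro s hs
    by_contra hne
    apply hpair
    refine ⟨k, ?_⟩
    simp only [count_pos_iff]
    rcases hbr : I.polarity r with _ | _ <;> rcases hbs : I.polarity s with _ | _
    · simp [hbr, hbs] at hne
    · exact ⟨⟨s, hbs, hs⟩, r, hbr, hr⟩
    · exact ⟨⟨r, hbr, hr⟩, s, hbs, hs⟩
    · simp [hbr, hbs] at hne
  rw [sur_eq_sum, Finset.mul_sum]
  have hterm : ∀ s, 0 ≤ sgn (I.polarity r) * (c.status s).surAt k (sgn (I.polarity s)) := by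
    intro s
    rcases hs : c.status s with _ | j | ⟨s, m⟩
    · simp [Status.surAt]
    · simp only [Status.surAt]
      split_ifs with hjk
      · obtain rfl : j = k := by
          by_contra hne
          exact hmin j (by omega) s hs
        rw [hpol s hs, sgn_mul_self]
        exact zero_le_one
      · simp
    · simp [Status.surAt]
  refine Finset.sum_pos' (fun s _ => hterm s) ⟨r, Finset.mem_univ r, ?_⟩
  simp [hr, Status.surAt, sgn_mul_self]

/-- The algorithm never gets stuck before all requests are matched. -/
theorem Valid.exists_step [DecidableEq ι] {f : PiecewiseLinearDelay} {I : Input ι} {c : Config ι}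
    (h : Valid f I c) (hun : ∃ r, ∀ s m, c.status r ≠ .matched s m) :
    ∃ c', Step f I c c' := by
  classical
  by_cases hpair : c.HasPair I
  · obtain ⟨k, h1, h2⟩ := hpair
    obtain ⟨r, hr, hrk⟩ := Config.count_pos_iff.1 h1
    obtain ⟨s, hs, hsk⟩ := Config.count_pos_iff.1 h2
    exact ⟨_, Step.pair c k r s hr hs hrk hsk⟩
  by_cases hdue : c.Due f I
  · rcases hdue with ⟨r, hr, ht⟩ | ⟨k, b, hact, hk, hfull⟩
    · exact ⟨_, Step.arrive c r hr ht.symm⟩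
    · obtain ⟨r, hr, hrk⟩ := Config.count_pos_iff.1 hact.1
      exact ⟨_, Step.move c k b r hpair hk hact hfull hr hrk⟩
  -- Every future event belongs to a request: its arrival, or the filling of its counter.
  let E : Finset ι := Finset.univ.filter fun r => c.status r = .future ∨
    ∃ k, c.status r = .waiting k ∧ c.Active I k (I.polarity r) ∧ f.HasNext k
  have hE : E.Nonempty := by
    by_cases hfut : ∃ r, c.status r = .future
    · obtain ⟨r, hr⟩ := hfut
      exact ⟨r, Finset.mem_filter.2 ⟨Finset.mem_univ r, Or.inl hr⟩⟩
    · push Not at hfut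
      obtain ⟨s, hs⟩ := hun
      have hw : ∃ k r, c.status r = .waiting k := by
        rcases hst : c.status s with _ | j | ⟨s', m⟩
        · exact absurd hst (hfut s)
        · exact ⟨j, s, hst⟩
        · exact absurd hst (hs s' m)
      obtain ⟨k, r, hrk, hact⟩ := Config.exists_active hpair hw
      refine ⟨r, Finset.mem_filter.2 ⟨Finset.mem_univ r, Or.inr ⟨k, hrk, hact, ?_⟩⟩⟩
      by_contra hlast
      have hle : ∀ r j, c.status r = .waiting j → j ≤ k := by
        intro r j hr
        by_contra! hkj
        exact hlast (PiecewiseLinearDelay.hasNext_of_lt (h.lt_pieces r j hr) hkj)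
      have h0 := hact.2
      rw [h.sur_eq_zero hle hfut, mul_zero] at h0
      exact lt_irrefl _ h0
  have hrate : ∀ k b, c.Active I k b → f.HasNext k → 0 < c.rate f I k b := by
    intro k b hact hk
    rw [Config.rate, if_pos hact]
    refine mul_pos (f.slope_pos k hk.lt_pieces) (abs_pos.2 fun h0 => ?_)
    have h3 := hact.2
    rw [Int.cast_eq_zero.1 h0, mul_zero] at h3
    exact lt_irrefl _ h3
  let τ : ι → ℝ := fun r => match c.status r with
    | .future => I.arrival r - c.time
    | .waiting k => (f.capacity k - c.counter k (I.polarity r)) / c.rate f I k (I.polarity r)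
    | .matched _ _ => 0
  have hτfut : ∀ r, c.status r = .future → τ r = I.arrival r - c.time := by
    intro r hr
    simp only [τ, hr]
  have hτwait : ∀ r k, c.status r = .waiting k → τ r =
      (f.capacity k - c.counter k (I.polarity r)) / c.rate f I k (I.polarity r) := by
    intro r k hr
    simp only [τ, hr]
  obtain ⟨r₀, hr₀, hmin⟩ := E.exists_min_image τ hE
  refine ⟨_, Step.wait c (τ r₀) ?_ hpair ?_ ?_ ?_⟩
  · rcases (Finset.mem_filter.1 hr₀).2 with hr | ⟨k, hr, hact, hk⟩
    · rw [hτfut r₀ hr]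
      refine sub_pos.2 (lt_of_le_of_ne (h.time_le_arrival r₀ hr) fun heq => ?_)
      exact hdue (Or.inl ⟨r₀, hr, heq⟩)
    · rw [hτwait r₀ k hr]
      refine div_pos (sub_pos.2 (lt_of_le_of_ne (h.counter_le k _ hk) fun heq => ?_))
        (hrate k _ hact hk)
      exact hdue (Or.inr ⟨k, _, hact, hk, heq⟩)
  · intro r hr
    have := hmin r (Finset.mem_filter.2 ⟨Finset.mem_univ r, Or.inl hr⟩)
    rw [hτfut r hr] at this
    linarith
  · intro k b hact hk
    obtain ⟨r, rfl, hr⟩ := Config.count_pos_iff.1 hact.1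
    have := hmin r (Finset.mem_filter.2 ⟨Finset.mem_univ r, Or.inr ⟨k, hr, hact, hk⟩⟩)
    rw [hτwait r k hr, le_div_iff₀ (hrate k _ hact hk)] at this
    linarith
  · rcases (Finset.mem_filter.1 hr₀).2 with hr | ⟨k, hr, hact, hk⟩
    · refine Or.inl ⟨r₀, hr, ?_⟩
      rw [hτfut r₀ hr]
      ring
    · refine Or.inr ⟨k, I.polarity r₀, hact, hk, ?_⟩
      rw [hτwait r₀ k hr, div_mul_cancel₀ _ (hrate k _ hact hk).ne']
      ring

/-! ### The potential of a level -/

/-- The potential of a level of capacity `y` with counter values `z`, if the surpluses of the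
algorithm and of the solution that it is compared with differ by `d`. -/
noncomputable def levelPotential (y : ℝ) (d : ℤ) (z : Bool → ℝ) : ℝ :=
  y * |(d : ℝ)| + 2 * (z true + z false) -
    3 * (if 0 < d then z true else if d < 0 then z false else 0)

section levelPotential

variable {y : ℝ} {z : Bool → ℝ}

lemma levelPotential_of_pos {d : ℤ} (hd : 0 < d) (y : ℝ) (z : Bool → ℝ) :
    levelPotential y d z = y * d + 2 * z false - z true := by
  have : (0 : ℝ) < d := Int.cast_pos.2 hd
  rw [levelPotential, if_pos hd, abs_of_pos this]
  ring

lemma levelPotential_of_neg {d : ℤ} (hd : d < 0) (y : ℝ) (z : Bool → ℝ) :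
    levelPotential y d z = -(y * d) + 2 * z true - z false := by
  have : (d : ℝ) < 0 := Int.cast_lt_zero.2 hd
  rw [levelPotential, if_neg hd.not_gt, if_pos hd, abs_of_neg this]
  ring

lemma levelPotential_zero (y : ℝ) (z : Bool → ℝ) :
    levelPotential y 0 z = 2 * (z true + z false) := by
  simp [levelPotential]

lemma levelPotential_nonneg (hz : ∀ b, 0 ≤ z b) (hzy : ∀ b, z b ≤ y) (d : ℤ) :
    0 ≤ levelPotential y d z := by
  have hy : 0 ≤ y := (hz true).trans (hzy true)
  rcases lt_trichotomy d 0 with hd | rfl | hd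
  · rw [levelPotential_of_neg hd]
    have h1 : (d : ℝ) ≤ -1 := by exact_mod_cast Int.le_sub_one_of_lt hd
    nlinarith [hz true, hzy false]
  · rw [levelPotential_zero]
    linarith [hz true, hz false]
  · rw [levelPotential_of_pos hd]
    have h1 : (1 : ℝ) ≤ d := by exact_mod_cast hd
    nlinarith [hz false, hzy true]

/-- Every unit by which the difference of the surpluses changes costs at most three capacities. -/
lemma levelPotential_le_add (hz : ∀ b, 0 ≤ z b) (hzy : ∀ b, z b ≤ y) (d d' : ℤ) :
    levelPotential y d' z ≤ levelPotential y d z + 3 * (y * |(d' : ℝ) - d|) := by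
  have hy : 0 ≤ y := (hz true).trans (hzy true)
  have key : y * |(d' : ℝ)| ≤ y * |(d : ℝ)| + y * |(d' : ℝ) - d| := by
    rw [← mul_add]
    refine mul_le_mul_of_nonneg_left ?_ hy
    have := abs_add_le (d : ℝ) (d' - d)
    rwa [add_sub_cancel] at this
  rcases eq_or_ne d' d with rfl | hne
  · simp
  have h1 : (1 : ℝ) ≤ |(d' : ℝ) - d| := by
    rw [← Int.cast_sub, ← Int.cast_abs]
    exact_mod_cast Int.one_le_abs (sub_ne_zero.2 hne)
  have h2 : y ≤ y * |(d' : ℝ) - d| := le_mul_of_one_le_right hy h1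
  have ht := hz true
  have hf := hz false
  have ht' := hzy true
  have hf' := hzy false
  -- A change of sign amounts to at least two units; the other cases need only one.
  rcases lt_trichotomy d 0 with hd | rfl | hd <;> rcases lt_trichotomy d' 0 with hd' | rfl | hd'
  · rw [levelPotential_of_neg hd, levelPotential_of_neg hd']
    rw [abs_of_neg (Int.cast_lt_zero.2 hd), abs_of_neg (Int.cast_lt_zero.2 hd')] at key
    linarith
  · rw [levelPotential_of_neg hd, levelPotential_zero]
    rw [abs_of_neg (Int.cast_lt_zero.2 hd)] at key
    simp only [Int.cast_zero, abs_zero] at key h2 ⊢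
    have h3 : y * d ≤ -y := by
      have : (d : ℝ) ≤ -1 := by exact_mod_cast Int.le_sub_one_of_lt hd
      nlinarith
    linarith
  · rw [levelPotential_of_neg hd, levelPotential_of_pos hd']
    have e1 : (d : ℝ) ≤ -1 := by exact_mod_cast Int.le_sub_one_of_lt hd
    have e2 : (1 : ℝ) ≤ d' := by exact_mod_cast hd'
    rw [abs_of_nonneg (by linarith : (0 : ℝ) ≤ d' - d)]
    nlinarith
  · rw [levelPotential_zero, levelPotential_of_neg hd']
    rw [abs_of_neg (Int.cast_lt_zero.2 hd')] at key
    simp only [Int.cast_zero, abs_zero] at key h2 ⊢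
    linarith
  · exact absurd rfl hne
  · rw [levelPotential_zero, levelPotential_of_pos hd']
    rw [abs_of_pos (Int.cast_pos.2 hd')] at key
    simp only [Int.cast_zero, abs_zero] at key h2 ⊢
    linarith
  · rw [levelPotential_of_pos hd, levelPotential_of_neg hd']
    have e1 : (d' : ℝ) ≤ -1 := by exact_mod_cast Int.le_sub_one_of_lt hd'
    have e2 : (1 : ℝ) ≤ d := by exact_mod_cast hd
    rw [abs_of_nonpos (by linarith : (d' : ℝ) - d ≤ 0)]
    nlinarith
  · rw [levelPotential_of_pos hd, levelPotential_zero]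
    rw [abs_of_pos (Int.cast_pos.2 hd)] at key
    simp only [Int.cast_zero, abs_zero] at key h2 ⊢
    have h3 : y ≤ y * d := by
      have : (1 : ℝ) ≤ d := by exact_mod_cast hd
      nlinarith
    linarith
  · rw [levelPotential_of_pos hd, levelPotential_of_pos hd']
    rw [abs_of_pos (Int.cast_pos.2 hd), abs_of_pos (Int.cast_pos.2 hd')] at key
    linarith

/-- A full counter pays for the move that it triggers and for the reset of both counters. -/
lemma levelPotential_move (hz : ∀ b, 0 ≤ z b) (hzy : ∀ b, z b ≤ y) {b : Bool} (hb : z b = y)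
    (d : ℤ) : levelPotential y (d - sgn b) (fun _ => 0) ≤ levelPotential y d z := by
  have hy : 0 ≤ y := (hz true).trans (hzy true)
  have ht := hz true
  have hf := hz false
  have ht' := hzy true
  have hf' := hzy false
  have hL : levelPotential y (d - sgn b) (fun _ => 0) = y * |((d - sgn b : ℤ) : ℝ)| := by
    simp [levelPotential]
  rw [hL]
  cases b
  · simp only [sgn, Bool.false_eq_true, if_false, sub_neg_eq_add, Int.cast_add, Int.cast_one]
    rcases lt_trichotomy d 0 with hd | rfl | hd
    · have h1 : (d : ℝ) ≤ -1 := by exact_mod_cast Int.le_sub_one_of_lt hd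
      rw [levelPotential_of_neg hd, abs_of_nonpos (by linarith)]
      linarith
    · rw [levelPotential_zero]
      simp
      linarith
    · have h1 : (0 : ℝ) < d := Int.cast_pos.2 hd
      rw [levelPotential_of_pos hd, abs_of_pos (by linarith)]
      linarith
  · simp only [sgn, if_true, Int.cast_sub, Int.cast_one]
    rcases lt_trichotomy d 0 with hd | rfl | hd
    · have h1 : (d : ℝ) < 0 := Int.cast_lt_zero.2 hd
      rw [levelPotential_of_neg hd, abs_of_neg (by linarith)]
      linarith
    · rw [levelPotential_zero]
      simp
      linarith
    · have h1 : (1 : ℝ) ≤ d := by exact_mod_cast hd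
      rw [levelPotential_of_pos hd, abs_of_nonneg (by linarith)]
      linarith

/-- While a counter increases, either the potential decreases at the same rate, or the surplus `o`
of the solution compared with is at least as large in absolute value as the surplus `s` of the
algorithm. -/
lemma levelPotential_increase (y : ℝ) (z : Bool → ℝ) {b : Bool} {s : ℤ} (o : ℤ) {θ : ℝ}
    (hθ : 0 ≤ θ) (hs : 0 < sgn b * s) :
    levelPotential y (s - o) (Function.update z b (z b + θ * |(s : ℝ)|)) ≤
      levelPotential y (s - o) z - θ * |(s : ℝ)| + 3 * (θ * |(o : ℝ)|) := by
  have ho : 0 ≤ θ * |(o : ℝ)| := by positivity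
  have hle : |(s : ℝ)| ≤ |(o : ℝ)| → θ * |(s : ℝ)| ≤ θ * |(o : ℝ)| := fun h =>
    mul_le_mul_of_nonneg_left h hθ
  generalize hd : s - o = d
  have hd' : (o : ℝ) = s - d := by
    rw [← hd]
    push_cast
    ring
  cases b
  · have hs0 : (s : ℝ) < 0 := by
      simp only [sgn, Bool.false_eq_true, if_false, neg_mul, one_mul, Left.neg_pos_iff] at hs
      exact Int.cast_lt_zero.2 hs
    rcases lt_trichotomy d 0 with h | rfl | h
    · rw [levelPotential_of_neg h, levelPotential_of_neg h]
      simp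
      linarith
    · have := hle (by rw [hd']; simp)
      rw [levelPotential_zero, levelPotential_zero]
      simp
      linarith
    · have h1 : (0 : ℝ) < d := Int.cast_pos.2 h
      have := hle (by rw [hd', abs_of_neg hs0, abs_of_neg (by linarith)]; linarith)
      rw [levelPotential_of_pos h, levelPotential_of_pos h]
      simp
      linarith
  · have hs0 : (0 : ℝ) < s := by
      simp only [sgn, if_true, one_mul] at hs
      exact Int.cast_pos.2 hs
    rcases lt_trichotomy d 0 with h | rfl | h
    · have h1 : (d : ℝ) < 0 := Int.cast_lt_zero.2 h
      have := hle (by rw [hd', abs_of_pos hs0, abs_of_pos (by linarith)]; linarith)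
      rw [levelPotential_of_neg h, levelPotential_of_neg h]
      simp
      linarith
    · have := hle (by rw [hd']; simp)
      rw [levelPotential_zero, levelPotential_zero]
      simp
      linarith
    · rw [levelPotential_of_pos h, levelPotential_of_pos h]
      simp
      linarith

end levelPotential

/-! ### The potential of a configuration -/

/-- The cost charged to a request that arrived at time `a`, at time `t`: its delay cost if it is
matched, and the value of the line that extends the piece of its level plus a nonnegative constant
if it is waiting. -/
noncomputable def requestCost (f : PiecewiseLinearDelay) (a t : ℝ) : Status ι → ℝ
  | .future => 0
  | .waiting k => f.toFun (f.brk k) + f.slope k * (t - a)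
  | .matched _ m => f.toFun (m - a)

/-- The cost charged to the algorithm. -/
noncomputable def algCost (f : PiecewiseLinearDelay) (I : Input ι) (c : Config ι) : ℝ :=
  ∑ r, requestCost f (I.arrival r) c.time (c.status r)

/-- The solution with the pairs `{r, p r}` that matches each pair at the arrival of its later
request has request `r` waiting. -/
def OtherWaits (p : ι → ι) (c : Config ι) (r : ι) : Prop :=
  c.status r ≠ .future ∧ c.status (p r) = .future

open Classical in
/-- The surplus of level `k` of the solution with the pairs `{r, p r}`, in which a waiting request
is on the levels that the delay function has not finished at its age. -/
noncomputable def otherSur (f : PiecewiseLinearDelay) (I : Input ι) (p : ι → ι) (c : Config ι)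
    (k : ℕ) : ℤ :=
  ∑ r, if OtherWaits p c r ∧ f.Unfinished k (c.time - I.arrival r) then sgn (I.polarity r) else 0

open Classical in
/-- The part of twelve times the cost of the solution with the pairs `{r, p r}` that has been
released so far; once both requests of a pair have arrived, each of them accounts for half of it.
While a request waits, six times its cost is released continuously, and three times the capacity of
a level when the request leaves that level by ageing; the rest is released when its partner arrives.
-/
noncomputable def releasedCost (f : PiecewiseLinearDelay) (I : Input ι) (p : ι → ι) (N : ℕ)
    (c : Config ι) : ℝ :=
  ∑ r, if c.status r = .future then 0
    else if c.status (p r) = .future then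
      6 * f.toFun (c.time - I.arrival r) + 3 * f.finishedCapacity N (c.time - I.arrival r)
    else 6 * f.toFun |I.arrival r - I.arrival (p r)|

open Classical in
/-- The potential of level `k`; the last level, whose counters are never full, has potential zero.
-/
noncomputable def potentialAt (f : PiecewiseLinearDelay) (I : Input ι) (p : ι → ι) (c : Config ι)
    (k : ℕ) : ℝ :=
  if f.HasNext k then
    levelPotential (f.capacity k) (c.sur I k - otherSur f I p c k) (c.counter k)
  else 0

/-- The balance of the analysis, which no step of the algorithm increases. The counters pay for the
moves. While time passes, the counters and the charge to the algorithm grow at three times the rate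
of the counters in total, whence the factor three of the potential. -/
noncomputable def balance (f : PiecewiseLinearDelay) (I : Input ι) (p : ι → ι) (N : ℕ)
    (c : Config ι) : ℝ :=
  algCost f I c +
    ∑ k ∈ Finset.range N,
      (c.counter k true + c.counter k false + 3 * potentialAt f I p c k) -
    3 * releasedCost f I p N c

section congr

variable {f : PiecewiseLinearDelay} {I : Input ι} {p : ι → ι} {c c' : Config ι}

lemma otherSur_congr (ht : c'.time = c.time)
    (hst : ∀ r, c'.status r = .future ↔ c.status r = .future) (k : ℕ) :
    otherSur f I p c' k = otherSur f I p c k := by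
  classical
  refine Finset.sum_congr rfl fun r _ => if_congr ?_ rfl rfl
  rw [OtherWaits, OtherWaits, ht, ne_eq, hst, hst]

lemma releasedCost_congr (ht : c'.time = c.time)
    (hst : ∀ r, c'.status r = .future ↔ c.status r = .future) (N : ℕ) :
    releasedCost f I p N c' = releasedCost f I p N c := by
  classical
  refine Finset.sum_congr rfl fun r _ => if_congr (hst r) rfl (if_congr (hst _) ?_ rfl)
  rw [ht]

end congr

lemma requestCost_matched_le {ι : Type*} (f : PiecewiseLinearDelay) {k : ℕ}
    (hk : (k : ℕ∞) < f.pieces) {a t : ℝ} (hat : a ≤ t) (s : ι) :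
    requestCost f a t (.matched s t) ≤ requestCost f a t (.waiting k : Status ι) := by
  refine (PiecewiseLinearDelay.toFun_le_tangent hk (sub_nonneg.2 hat)).trans ?_
  have h1 := f.slope_pos k hk
  have h2 := PiecewiseLinearDelay.brk_nonneg hk
  simp only [PiecewiseLinearDelay.tangent, requestCost]
  linarith [mul_nonneg h1.le h2]

lemma requestCost_succ_le {ι : Type*} {f : PiecewiseLinearDelay} {k : ℕ} (hk : f.HasNext k)
    {a t : ℝ} (hat : a ≤ t) :
    requestCost f a t (.waiting (k + 1) : Status ι) ≤
      requestCost f a t (.waiting k : Status ι) + f.capacity k := by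
  have h1 := mul_le_mul_of_nonneg_right (PiecewiseLinearDelay.slope_anti hk (Nat.le_succ k))
    (sub_nonneg.2 hat)
  simp only [requestCost, PiecewiseLinearDelay.capacity]
  linarith

section steps

variable {f : PiecewiseLinearDelay} {I : Input ι} {p : ι → ι} {N : ℕ} {c : Config ι}

lemma potentialAt_nonneg (h : Valid f I c) (k : ℕ) : 0 ≤ potentialAt f I p c k := by
  rw [potentialAt]
  split_ifs with hk
  · exact levelPotential_nonneg (h.counter_nonneg k) (fun b => h.counter_le k b hk) _
  · exact le_rfl

/-- On the last level both surpluses count all requests that have arrived. -/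
lemma otherSur_eq_sur (h : Valid f I c) (hp : ∀ r, p (p r) = r)
    (hpol : ∀ r, I.polarity (p r) ≠ I.polarity r) {k : ℕ} (hk : ¬ f.HasNext k) :
    otherSur f I p c k = c.sur I k := by
  classical
  have hle : ∀ r j, c.status r = .waiting j → j ≤ k := by
    intro r j hr
    by_contra! hkj
    exact hk (PiecewiseLinearDelay.hasNext_of_lt (h.lt_pieces r j hr) hkj)
  rw [h.sur_eq_arrived hle, otherSur, eq_comm, ← sub_eq_zero, ← Finset.sum_sub_distrib]
  have hun : ∀ x, f.Unfinished k x := fun x hk' => absurd hk' hk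
  have harr : ∀ r, (c.status r).arrivedAt (sgn (I.polarity r)) =
      if c.status r = .future then 0 else sgn (I.polarity r) := by
    intro r
    rcases c.status r with _ | j | ⟨s, m⟩ <;> simp [Status.arrivedAt]
  simp only [OtherWaits, hun, and_true, harr]
  refine Finset.sum_involution (fun r _ => p r) ?_ ?_ (fun _ _ => Finset.mem_univ _)
    (fun r _ => hp r)
  · intro r _
    rw [hp r, sgn_eq_neg_of_ne (hpol r)]
    by_cases h1 : c.status r = .future <;> by_cases h2 : c.status (p r) = .future <;>
      simp [h1, h2]
  · intro r _ _ heq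
    exact hpol r (by rw [heq])

variable [DecidableEq ι]

lemma balance_pair_le (h : Valid f I c) {k : ℕ} {r s : ι} (hr : I.polarity r = true)
    (hs : I.polarity s = false) (hrk : c.status r = .waiting k) (hsk : c.status s = .waiting k) :
    balance f I p N { c with
      status := Function.update (Function.update c.status r (.matched s c.time)) s
        (.matched r c.time) } ≤ balance f I p N c := by
  set c' : Config ι := { c with
    status := Function.update (Function.update c.status r (.matched s c.time)) s
      (.matched r c.time) } with hc'
  have hsr : s ≠ r := by
    rintro rfl
    rw [hr] at hs
    cases hs
  have hfut : ∀ x, c'.status x = .future ↔ c.status x = .future := by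
    intro x
    simp only [hc', Function.update_apply]
    split_ifs with h1 h2
    · simp [h1, hsk]
    · simp [h2, hrk]
    · rfl
  have hsur : ∀ j, c'.sur I j = c.sur I j := by
    intro j
    rw [Config.sur_eq_sum, Config.sur_eq_sum]
    simp only [hc']
    rw [sum_update (fun x st => Status.surAt j (sgn (I.polarity x)) st),
      sum_update (fun x st => Status.surAt j (sgn (I.polarity x)) st), Function.update_of_ne hsr,
      hrk, hsk, hr, hs]
    by_cases hkj : k ≤ j <;> simp [Status.surAt, sgn, hkj]
  have hcost : algCost f I c' ≤ algCost f I c := by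
    simp only [algCost, hc']
    rw [sum_update (fun x st => requestCost f (I.arrival x) c.time st),
      sum_update (fun x st => requestCost f (I.arrival x) c.time st), Function.update_of_ne hsr,
      hrk, hsk]
    have h1 := requestCost_matched_le f (h.lt_pieces r k hrk)
      (h.arrival_le_time r (by simp [hrk])) s
    have h2 := requestCost_matched_le f (h.lt_pieces s k hsk)
      (h.arrival_le_time s (by simp [hsk])) r
    linarith
  have hpot : ∀ j, potentialAt f I p c' j = potentialAt f I p c j := by
    intro j
    rw [potentialAt, potentialAt, hsur, otherSur_congr (c := c) (c' := c') rfl hfut]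
  have hctr : c'.counter = c.counter := rfl
  simp only [balance, hpot, hctr, releasedCost_congr (c := c) (c' := c') rfl hfut]
  linarith

lemma balance_move_le (h : Valid f I c) (hlev : ∀ r k, c.status r = .waiting k → k < N)
    {k : ℕ} {b : Bool} {r : ι} (hk : f.HasNext k) (hfull : c.counter k b = f.capacity k)
    (hr : I.polarity r = b) (hrk : c.status r = .waiting k) :
    balance f I p N { c with
      status := Function.update c.status r (.waiting (k + 1))
      counter := Function.update c.counter k (fun _ => 0) } ≤ balance f I p N c := by
  set c' : Config ι := { c with
    status := Function.update c.status r (.waiting (k + 1))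
    counter := Function.update c.counter k (fun _ => 0) } with hc'
  have hfut : ∀ x, c'.status x = .future ↔ c.status x = .future := by
    intro x
    simp only [hc', Function.update_apply]
    split_ifs with h1
    · simp [h1, hrk]
    · rfl
  have hsur : ∀ j, c'.sur I j = c.sur I j - if j = k then sgn b else 0 := by
    intro j
    rw [Config.sur_eq_sum, Config.sur_eq_sum]
    simp only [hc']
    rw [sum_update (fun x st => Status.surAt j (sgn (I.polarity x)) st), hrk, hr]
    simp only [Status.surAt]
    rcases lt_trichotomy j k with hj | rfl | hj
    · simp [hj.ne, show ¬ k ≤ j by omega, show ¬ k + 1 ≤ j by omega]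
    · simp [sub_eq_add_neg]
    · simp [hj.ne', show k ≤ j by omega, show k + 1 ≤ j by omega]
  have hcost : algCost f I c' ≤ algCost f I c + f.capacity k := by
    simp only [algCost, hc']
    rw [sum_update (fun x st => requestCost f (I.arrival x) c.time st), hrk]
    have h1 := requestCost_succ_le (ι := ι) hk (h.arrival_le_time r (by simp [hrk]))
    linarith
  have hlevels : ∑ j ∈ Finset.range N,
        (c'.counter j true + c'.counter j false + 3 * potentialAt f I p c' j) ≤
      ∑ j ∈ Finset.range N,
        (c.counter j true + c.counter j false + 3 * potentialAt f I p c j) - f.capacity k := by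
    have hkN := Finset.mem_range.2 (hlev r k hrk)
    rw [← Finset.add_sum_erase _ _ hkN, ← Finset.add_sum_erase _ _ hkN]
    have herase : ∑ j ∈ (Finset.range N).erase k,
          (c'.counter j true + c'.counter j false + 3 * potentialAt f I p c' j) =
        ∑ j ∈ (Finset.range N).erase k,
          (c.counter j true + c.counter j false + 3 * potentialAt f I p c j) := by
      refine Finset.sum_congr rfl fun j hj => ?_
      have hjk : j ≠ k := Finset.ne_of_mem_erase hj
      rw [potentialAt, potentialAt, hsur, otherSur_congr (c := c) (c' := c') rfl hfut,
        if_neg hjk, sub_zero]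
      simp [hc', hjk]
    have hctr : f.capacity k ≤ c.counter k true + c.counter k false := by
      have h1 := h.counter_nonneg k true
      have h2 := h.counter_nonneg k false
      cases b <;> linarith
    have hpot : potentialAt f I p c' k ≤ potentialAt f I p c k := by
      rw [potentialAt, potentialAt, if_pos hk, if_pos hk, hsur,
        otherSur_congr (c := c) (c' := c') rfl hfut, if_pos rfl, sub_right_comm]
      simp only [hc', Function.update_self]
      exact levelPotential_move (h.counter_nonneg k) (fun b => h.counter_le k b hk) hfull _
    have hz : c'.counter k true + c'.counter k false = 0 := by simp [hc']
    rw [herase, hz]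
    linarith
  simp only [balance, releasedCost_congr (c := c) (c' := c') rfl hfut]
  linarith

lemma finishedCapacity_zero (f : PiecewiseLinearDelay) (N : ℕ) : f.finishedCapacity N 0 = 0 := by
  refine Finset.sum_eq_zero fun k _ => if_pos fun hk => hk.brk_succ_pos

/-- At an arrival the two surpluses change by the same amount, except on the levels that the partner
of the arriving request has already left by ageing. -/
lemma balance_arrive_le (h : Valid f I c) (hp : ∀ r, p (p r) = r)
    (hpol : ∀ r, I.polarity (p r) ≠ I.polarity r) {r : ι} (hr : c.status r = .future)
    (ht : I.arrival r = c.time) :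
    balance f I p N { c with status := Function.update c.status r (.waiting 0) } ≤
      balance f I p N c := by
  classical
  set c' : Config ι := { c with status := Function.update c.status r (.waiting 0) } with hc'
  have hpr : r ≠ p r := fun heq => hpol r (by rw [← heq])
  have hself : c'.status r = .waiting 0 := by simp [hc']
  have hother : ∀ x, x ≠ r → c'.status x = c.status x := fun x hx => by simp [hc', hx]
  have hpart : c'.status (p r) = c.status (p r) := hother _ hpr.symm
  have hunaff : ∀ x, x ≠ r → x ≠ p r →
      c'.status x = c.status x ∧ c'.status (p x) = c.status (p x) := by
    intro x h1 h2
    refine ⟨hother x h1, hother _ fun h3 => h2 ?_⟩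
    rw [← h3, hp]
  have hsur : ∀ k, c'.sur I k = c.sur I k + sgn (I.polarity r) := by
    intro k
    rw [Config.sur_eq_sum, Config.sur_eq_sum]
    simp only [hc']
    rw [sum_update (fun x st => Status.surAt k (sgn (I.polarity x)) st), hr]
    simp [Status.surAt]
  have hcost : algCost f I c' = algCost f I c := by
    simp only [algCost, hc']
    rw [sum_update (fun x st => requestCost f (I.arrival x) c.time st), hr]
    simp [requestCost, f.brk_zero, f.map_zero, ht]
  by_cases hq : c.status (p r) = .future
  · have hosur : ∀ k, otherSur f I p c' k = otherSur f I p c k + sgn (I.polarity r) := by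
      intro k
      rw [← sub_eq_iff_eq_add', otherSur, otherSur, ← Finset.sum_sub_distrib,
        Finset.sum_eq_single r]
      · have h0 : f.Unfinished k (c.time - I.arrival r) := by
          rw [ht, sub_self]
          exact fun hk => hk.brk_succ_pos
        have h1 : OtherWaits p c' r := ⟨by simp [hself], by rw [hpart, hq]⟩
        have h2 : ¬ OtherWaits p c r := fun h' => h'.1 hr
        have h0' : f.Unfinished k (c'.time - I.arrival r) := h0
        rw [if_pos ⟨h1, h0'⟩, if_neg fun h' => h2 h'.1, sub_zero]
      · intro x _ hx
        by_cases hxp : x = p r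
        · subst hxp
          simp [OtherWaits, hpart, hq]
        · obtain ⟨h1, h2⟩ := hunaff x hx hxp
          rw [sub_eq_zero]
          exact if_congr (by rw [OtherWaits, OtherWaits, h1, h2]) rfl rfl
      · simp
    have hrel : releasedCost f I p N c' = releasedCost f I p N c := by
      refine Finset.sum_congr rfl fun x _ => ?_
      by_cases hx : x = r
      · subst hx
        have h0 : c'.time - I.arrival x = 0 := by rw [ht]; exact sub_self _
        rw [if_neg (by simp [hself]), if_pos (by rw [hpart, hq]), if_pos hr, h0, f.map_zero,
          finishedCapacity_zero]
        ring
      · by_cases hxp : x = p r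
        · subst hxp
          rw [if_pos (by rw [hpart, hq]), if_pos hq]
        · obtain ⟨h1, h2⟩ := hunaff x hx hxp
          rw [h1, h2]
    have hpot : ∀ k, potentialAt f I p c' k = potentialAt f I p c k := by
      intro k
      rw [potentialAt, potentialAt, hsur, hosur, add_sub_add_right_eq_sub]
    simp only [balance, hpot, hcost, hrel]
    exact le_rfl
  · set x₀ := c.time - I.arrival (p r) with hx₀
    have hx₀0 : 0 ≤ x₀ := sub_nonneg.2 (h.arrival_le_time _ hq)
    have hosur : ∀ k, otherSur f I p c' k = otherSur f I p c k +
        if f.Unfinished k x₀ then sgn (I.polarity r) else 0 := by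
      intro k
      rw [← sub_eq_iff_eq_add', otherSur, otherSur, ← Finset.sum_sub_distrib,
        Finset.sum_eq_single (p r)]
      · have h1 : ¬ OtherWaits p c' (p r) := by
          rintro ⟨-, h'⟩
          rw [hp, hself] at h'
          cases h'
        have h2 : OtherWaits p c (p r) := ⟨hq, by rw [hp, hr]⟩
        rw [if_neg fun h' => h1 h'.1]
        simp only [h2, true_and, ← hx₀]
        rw [sgn_eq_neg_of_ne (hpol r)]
        split_ifs <;> simp
      · intro x _ hx
        by_cases hxr : x = r
        · subst hxr
          simp [OtherWaits, hpart, hq, hr]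
        · obtain ⟨h1, h2⟩ := hunaff x hxr hx
          rw [sub_eq_zero]
          exact if_congr (by rw [OtherWaits, OtherWaits, h1, h2]) rfl rfl
      · simp
    have hrel : releasedCost f I p N c' =
        releasedCost f I p N c + (6 * f.toFun x₀ - 3 * f.finishedCapacity N x₀) := by
      rw [← sub_eq_iff_eq_add', releasedCost, releasedCost, ← Finset.sum_sub_distrib,
        Finset.sum_eq_add_of_mem r (p r) (Finset.mem_univ _) (Finset.mem_univ _) hpr]
      · have e1 : |I.arrival r - I.arrival (p r)| = x₀ := by
          rw [ht, ← hx₀, abs_of_nonneg hx₀0]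
        have e2 : |I.arrival (p r) - I.arrival r| = x₀ := by
          rw [abs_sub_comm, e1]
        rw [hself, hpart, hp, hself, hr, if_neg (by simp), if_neg hq, if_pos rfl, if_neg hq,
          if_neg (by simp), if_neg hq, if_pos rfl, e1, e2, ← hx₀]
        ring
      · rintro x - ⟨h1, h2⟩
        obtain ⟨h3, h4⟩ := hunaff x h1 h2
        rw [h3, h4]
        exact sub_self _
    have hpot : ∀ k, potentialAt f I p c' k ≤ potentialAt f I p c k +
        3 * if f.Unfinished k x₀ then 0 else f.capacity k := by
      intro k
      rw [potentialAt, potentialAt, hsur, hosur]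
      by_cases hun : f.Unfinished k x₀
      · rw [if_pos hun, if_pos hun, add_sub_add_right_eq_sub, mul_zero, add_zero]
      · have hk := PiecewiseLinearDelay.hasNext_of_not_unfinished hun
        rw [if_neg hun, if_neg hun, if_pos hk, if_pos hk, add_zero]
        refine (levelPotential_le_add (h.counter_nonneg k) (fun b => h.counter_le k b hk)
          (c.sur I k - otherSur f I p c k) _).trans (le_of_eq ?_)
        have hone : |((sgn (I.polarity r) : ℤ) : ℝ)| = 1 := by exact_mod_cast abs_sgn _
        have e : (((c.sur I k + sgn (I.polarity r) - otherSur f I p c k : ℤ) : ℝ) -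
            ((c.sur I k - otherSur f I p c k : ℤ) : ℝ)) = ((sgn (I.polarity r) : ℤ) : ℝ) := by
          push_cast
          ring
        rw [e, hone, mul_one]
    have hlevels : ∑ k ∈ Finset.range N,
          (c'.counter k true + c'.counter k false + 3 * potentialAt f I p c' k) ≤
        ∑ k ∈ Finset.range N,
          (c.counter k true + c.counter k false + 3 * potentialAt f I p c k) +
          9 * f.finishedCapacity N x₀ := by
      rw [PiecewiseLinearDelay.finishedCapacity, Finset.mul_sum, ← Finset.sum_add_distrib]
      refine Finset.sum_le_sum fun k _ => ?_
      have h1 : c'.counter k true + c'.counter k false =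
        c.counter k true + c.counter k false := rfl
      rw [h1]
      linarith [hpot k]
    have hfin := f.finishedCapacity_le N hx₀0
    simp only [balance, hcost, hrel]
    linarith

end steps

/-! ### Waiting -/

/-- A function on an interval decreases if it decreases on all subintervals whose interior avoids a
given finite set. -/
lemma le_of_forall_avoiding {F : ℝ → ℝ} (B : Finset ℝ) {u v : ℝ} (huv : u ≤ v)
    (h : ∀ s t, u ≤ s → s ≤ t → t ≤ v → (∀ b ∈ B, ¬ (s < b ∧ b < t)) → F t ≤ F s) :
    F v ≤ F u := by
  classical
  induction B using Finset.induction_on generalizing u v with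
  | empty => exact h u v le_rfl huv le_rfl (by simp)
  | insert b B _ ih =>
    by_cases hb : u < b ∧ b < v
    · refine (ih hb.2.le fun s t hs hst ht havoid => ?_).trans
        (ih hb.1.le fun s t hs hst ht havoid => ?_)
      · refine h s t (hb.1.le.trans hs) hst ht fun b' hb' => ?_
        rcases Finset.mem_insert.1 hb' with rfl | hb'
        · exact fun h' => absurd h'.1 (not_lt.2 hs)
        · exact havoid b' hb'
      · refine h s t hs hst (ht.trans hb.2.le) fun b' hb' => ?_
        rcases Finset.mem_insert.1 hb' with rfl | hb'
        · exact fun h' => absurd h'.2 (not_lt.2 ht)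
        · exact havoid b' hb'
    · refine ih huv fun s t hs hst ht havoid => h s t hs hst ht fun b' hb' => ?_
      rcases Finset.mem_insert.1 hb' with rfl | hb'
      · exact fun h' => hb ⟨hs.trans_lt h'.1, h'.2.trans_le ht⟩
      · exact havoid b' hb'

namespace Config

lemma advance_zero (f : PiecewiseLinearDelay) (I : Input ι) (c : Config ι) :
    c.advance f I 0 = c := by
  simp [advance]

lemma advance_advance (f : PiecewiseLinearDelay) (I : Input ι) (c : Config ι) (s t : ℝ) :
    (c.advance f I s).advance f I t = c.advance f I (s + t) := by
  have hrate : ∀ k b, (c.advance f I s).rate f I k b = c.rate f I k b := fun _ _ => rfl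
  have htime : c.time + s + t = c.time + (s + t) := add_assoc _ _ _
  have hcounter : (fun k b => c.counter k b + s * c.rate f I k b +
      t * (c.advance f I s).rate f I k b) =
      fun k b => c.counter k b + (s + t) * c.rate f I k b := by
    funext k b
    rw [hrate]
    ring
  exact congrArg₂ (fun x y => (⟨x, c.status, y⟩ : Config ι)) htime hcounter

/-- At most one of the two counters of a level increases. -/
lemma rate_cases (f : PiecewiseLinearDelay) (I : Input ι) (c : Config ι) (k : ℕ) :
    (∃ b, 0 < sgn b * c.sur I k ∧ c.rate f I k b = f.slope k * |(c.sur I k : ℝ)| ∧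
      c.rate f I k (!b) = 0) ∨ ∀ b, c.rate f I k b = 0 := by
  by_cases hact : ∃ b, c.Active I k b
  · obtain ⟨b, hb⟩ := hact
    refine Or.inl ⟨b, hb.2, if_pos hb, if_neg fun h' => ?_⟩
    have := h'.2
    rw [sgn_not] at this
    linarith [hb.2]
  · push Not at hact
    exact Or.inr fun b => if_neg (hact b)

lemma rate_add_rate_le (f : PiecewiseLinearDelay) (I : Input ι) (c : Config ι) {k : ℕ}
    (hk : (k : ℕ∞) < f.pieces) :
    c.rate f I k true + c.rate f I k false ≤ f.slope k * |(c.sur I k : ℝ)| := by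
  have h0 : 0 ≤ f.slope k * |(c.sur I k : ℝ)| := mul_nonneg (f.slope_pos k hk).le (abs_nonneg _)
  rcases c.rate_cases f I k with ⟨b, -, h1, h2⟩ | h
  · cases b <;> simp only [Bool.not_true, Bool.not_false] at h2 <;> linarith
  · rw [h, h]
    linarith

/-- Let `v` be the surplus of the level before `k`. The number of requests on level `k` is at most
the sum of the absolute values of the surplus of level `k` and of `v`, and if the counters of level
`k` are not active, then it is the difference of `|v|` and the absolute value of the surplus. -/
lemma slope_mul_count_le (f : PiecewiseLinearDelay) {I : Input ι} {c : Config ι}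
    (hpair : ¬ c.HasPair I) {k : ℕ} (hk : (k : ℕ∞) < f.pieces) {v : ℤ}
    (hv : c.sur I k = v + ((c.count I k true : ℤ) - c.count I k false)) :
    f.slope k * ((c.count I k true : ℝ) + c.count I k false) +
        f.slope k * |(c.sur I k : ℝ)| / 2 ≤
      2 * (c.rate f I k true + c.rate f I k false) + f.slope k * |(v : ℝ)| := by
  have hs := (f.slope_pos k hk).le
  have hzero : c.count I k true = 0 ∨ c.count I k false = 0 := by
    by_contra! hne
    exact hpair ⟨k, Nat.pos_of_ne_zero hne.1, Nat.pos_of_ne_zero hne.2⟩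
  have hv' : (v : ℝ) =
      c.sur I k - ((c.count I k true : ℝ) - c.count I k false) := by
    have : v = c.sur I k - ((c.count I k true : ℤ) - c.count I k false) := by linarith
    rw [this]
    push_cast
    ring
  obtain ⟨X, hX, hX'⟩ : ∃ X : ℝ,
      c.rate f I k true + c.rate f I k false = f.slope k * X ∧
      ((c.count I k true : ℝ) + c.count I k false) + |(c.sur I k : ℝ)| / 2 ≤
        2 * X + |(v : ℝ)| := by
    have hvabs : |(c.count I k true : ℝ) - c.count I k false| ≤ |(c.sur I k : ℝ)| + |(v : ℝ)| := by
      have h1 : (c.count I k true : ℝ) - c.count I k false = c.sur I k - v := by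
        rw [hv']
        ring
      rw [h1]
      exact abs_sub _ _
    have hn : |(c.count I k true : ℝ) - c.count I k false| =
        (c.count I k true : ℝ) + c.count I k false := by
      rcases hzero with h0 | h0 <;> simp [h0]
    rw [hn] at hvabs
    by_cases hact : ∃ b, c.Active I k b
    · obtain ⟨b, hb⟩ := hact
      refine ⟨|(c.sur I k : ℝ)|, ?_, by linarith [abs_nonneg (c.sur I k : ℝ)]⟩
      have hnb : ¬ c.Active I k (!b) := by
        intro h'
        have := h'.2
        rw [sgn_not] at this
        linarith [hb.2]
      cases b
      · rw [Bool.not_false] at hnb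
        rw [rate, rate, if_pos hb, if_neg hnb, zero_add]
      · rw [Bool.not_true] at hnb
        rw [rate, rate, if_pos hb, if_neg hnb, add_zero]
    · push Not at hact
      refine ⟨0, by rw [rate, rate, if_neg (hact _), if_neg (hact _)]; ring, ?_⟩
      have ht : 0 < c.count I k true → (c.sur I k : ℝ) ≤ 0 := by
        intro h'
        by_contra! hpos
        exact hact true ⟨h', by simpa [sgn] using hpos⟩
      have hf : 0 < c.count I k false → 0 ≤ (c.sur I k : ℝ) := by
        intro h'
        by_contra! hneg
        exact hact false ⟨h', by simpa [sgn] using hneg⟩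
      have key : |(v : ℝ)| = |(c.sur I k : ℝ)| +
          ((c.count I k true : ℝ) + c.count I k false) := by
        rw [hv']
        rcases hzero with h0 | h0
        · rcases Nat.eq_zero_or_pos (c.count I k false) with h1 | h1
          · simp [h0, h1]
          · have := hf h1
            simp only [h0, Nat.cast_zero, zero_sub, sub_neg_eq_add, zero_add]
            rw [abs_of_nonneg this, abs_of_nonneg (by positivity)]
        · rcases Nat.eq_zero_or_pos (c.count I k true) with h1 | h1
          · simp [h0, h1]
          · have := ht h1
            have hcnt : (0 : ℝ) ≤ c.count I k true := Nat.cast_nonneg _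
            simp only [h0, Nat.cast_zero, sub_zero, add_zero]
            rw [abs_of_nonpos this, abs_of_nonpos (by linarith)]
            ring
      rw [key]
      linarith [abs_nonneg (c.sur I k : ℝ)]
  rw [hX]
  have := mul_le_mul_of_nonneg_left hX' hs
  linarith

/-- The algorithm is charged for waiting at most twice the rate at which its counters increase: a
level that is not active has a surplus that is at most that of the previous level, on which the
slope is at least twice as large. -/
lemma sum_slope_mul_count_le (f : PiecewiseLinearDelay) {I : Input ι} {c : Config ι}
    (hpair : ¬ c.HasPair I) {N : ℕ} (hN : (N : ℕ∞) ≤ f.pieces) :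
    ∑ k ∈ Finset.range N, f.slope k * ((c.count I k true : ℝ) + c.count I k false) ≤
      2 * ∑ k ∈ Finset.range N, (c.rate f I k true + c.rate f I k false) := by
  rcases N with _ | n
  · simp
  have hn : (n : ℕ∞) < f.pieces := lt_of_lt_of_le (Nat.cast_lt.2 (Nat.lt_succ_self n)) hN
  suffices h : ∀ m ≤ n,
      ∑ k ∈ Finset.range (m + 1), f.slope k * ((c.count I k true : ℝ) + c.count I k false) +
        f.slope m * |(c.sur I m : ℝ)| / 2 ≤
      2 * ∑ k ∈ Finset.range (m + 1), (c.rate f I k true + c.rate f I k false) by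
    have h1 := mul_nonneg (f.slope_pos n hn).le (abs_nonneg (c.sur I n : ℝ))
    linarith [h n le_rfl]
  intro m
  induction m with
  | zero =>
    intro _
    have := slope_mul_count_le f hpair (k := 0) (v := 0) (by simpa using f.pieces_pos)
      (by simp [sur])
    simpa using this
  | succ m ih =>
    intro hm
    have hlt := PiecewiseLinearDelay.lt_pieces_of_le hn hm
    have h1 := slope_mul_count_le f hpair hlt (c.sur_succ I m)
    have h2 := mul_le_mul_of_nonneg_right (f.slope_halving m hlt) (abs_nonneg (c.sur I m : ℝ))
    rw [Finset.sum_range_succ, Finset.sum_range_succ _ (m + 1), mul_add]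
    linarith [ih (by omega)]

end Config

section waiting

variable {f : PiecewiseLinearDelay} {I : Input ι} {p : ι → ι} {N : ℕ} {c : Config ι}

lemma algCost_advance (f : PiecewiseLinearDelay) (I : Input ι)
    (hlev : ∀ r k, c.status r = .waiting k → k < N) (δ : ℝ) :
    algCost f I (c.advance f I δ) = algCost f I c +
      δ * ∑ k ∈ Finset.range N, f.slope k * ((c.count I k true : ℝ) + c.count I k false) := by
  classical
  have hcount : ∀ k, (c.count I k true : ℝ) + c.count I k false =
      ∑ r, if c.status r = .waiting k then 1 else 0 := by
    intro k
    simp only [Config.count, Finset.card_filter, Nat.cast_sum]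
    rw [← Finset.sum_add_distrib]
    refine Finset.sum_congr rfl fun r _ => ?_
    by_cases h : c.status r = .waiting k <;> cases I.polarity r <;> simp [h]
  simp only [hcount, Finset.mul_sum]
  rw [Finset.sum_comm, algCost, algCost, ← Finset.sum_add_distrib]
  refine Finset.sum_congr rfl fun r _ => ?_
  change requestCost f (I.arrival r) (c.time + δ) (c.status r) = _
  rcases hr : c.status r with _ | j | ⟨s, m⟩
  · simp [requestCost]
  · simp only [requestCost, Status.waiting.injEq, mul_ite, mul_one, mul_zero, Finset.sum_ite_eq,
      Finset.mem_range, hlev r j hr, if_true]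
    ring
  · simp [requestCost]

open Classical in
lemma abs_otherSur_le (f : PiecewiseLinearDelay) (I : Input ι) (p : ι → ι) (c : Config ι)
    (k : ℕ) : |(otherSur f I p c k : ℝ)| ≤
      ∑ r, if OtherWaits p c r ∧ f.Unfinished k (c.time - I.arrival r) then 1 else 0 := by
  rw [otherSur, Int.cast_sum]
  refine (Finset.abs_sum_le_sum_abs _ _).trans (Finset.sum_le_sum fun r _ => ?_)
  split_ifs
  · exact_mod_cast (abs_sgn _).le
  · simp

open Classical in
/-- While time passes, the surplus of the solution compared with changes only by the requests that
leave the level by ageing. -/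
lemma abs_otherSur_advance_sub_le (f : PiecewiseLinearDelay) (I : Input ι) (p : ι → ι)
    (c : Config ι) {δ : ℝ} (hδ : 0 ≤ δ) (k : ℕ) :
    |(otherSur f I p (c.advance f I δ) k : ℝ) - otherSur f I p c k| ≤
      ∑ r, if OtherWaits p c r then
        (if f.Unfinished k (c.time + δ - I.arrival r) then 0 else 1) -
          (if f.Unfinished k (c.time - I.arrival r) then 0 else 1) else 0 := by
  rw [otherSur, otherSur, Int.cast_sum, Int.cast_sum, ← Finset.sum_sub_distrib]
  refine (Finset.abs_sum_le_sum_abs _ _).trans (Finset.sum_le_sum fun r _ => ?_)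
  have hw : OtherWaits p (c.advance f I δ) r ↔ OtherWaits p c r := Iff.rfl
  have ht : (c.advance f I δ).time - I.arrival r = c.time + δ - I.arrival r := rfl
  have hone : |((sgn (I.polarity r) : ℤ) : ℝ)| = 1 := by exact_mod_cast abs_sgn _
  have hmono : f.Unfinished k (c.time + δ - I.arrival r) →
      f.Unfinished k (c.time - I.arrival r) := fun h => h.of_le (by linarith)
  simp only [hw, ht]
  by_cases h0 : OtherWaits p c r <;>
    by_cases h1 : f.Unfinished k (c.time + δ - I.arrival r) <;>
    by_cases h2 : f.Unfinished k (c.time - I.arrival r) <;>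
    simp [h0, h1, h2, hone]
  exact absurd (hmono h1) h2

/-- The potential of a level decreases at the rate at which its counters increase, up to what the
solution compared with pays for. -/
lemma potentialAt_advance_le (h : Valid f I c) (hp : ∀ r, p (p r) = r)
    (hpol : ∀ r, I.polarity (p r) ≠ I.polarity r) {δ : ℝ} (hδ : 0 ≤ δ)
    (h' : Valid f I (c.advance f I δ)) {k : ℕ} (hk : (k : ℕ∞) < f.pieces) :
    potentialAt f I p (c.advance f I δ) k ≤
      potentialAt f I p c k - δ * (c.rate f I k true + c.rate f I k false) +
        3 * (δ * f.slope k * |(otherSur f I p c k : ℝ)|) +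
        3 * (f.capacity k *
          |(otherSur f I p (c.advance f I δ) k : ℝ) - otherSur f I p c k|) := by
  have hs := (f.slope_pos k hk).le
  have hsur : (c.advance f I δ).sur I k = c.sur I k := rfl
  by_cases hnext : f.HasNext k
  · rw [potentialAt, potentialAt, if_pos hnext, if_pos hnext, hsur]
    have h1 := levelPotential_le_add (h'.counter_nonneg k) (fun b => h'.counter_le k b hnext)
      (c.sur I k - otherSur f I p c k) (c.sur I k - otherSur f I p (c.advance f I δ) k)
    have e1 : |((c.sur I k - otherSur f I p (c.advance f I δ) k : ℤ) : ℝ) -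
        ((c.sur I k - otherSur f I p c k : ℤ) : ℝ)| =
        |(otherSur f I p (c.advance f I δ) k : ℝ) - otherSur f I p c k| := by
      push_cast
      rw [abs_sub_comm]
      congr 1
      ring
    rw [e1] at h1
    have h2 : levelPotential (f.capacity k) (c.sur I k - otherSur f I p c k)
          ((c.advance f I δ).counter k) ≤
        levelPotential (f.capacity k) (c.sur I k - otherSur f I p c k) (c.counter k) -
          δ * (c.rate f I k true + c.rate f I k false) +
          3 * (δ * f.slope k * |(otherSur f I p c k : ℝ)|) := by
      rcases c.rate_cases f I k with ⟨b, hb, hr1, hr2⟩ | hr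
      · have hupd : (c.advance f I δ).counter k = Function.update (c.counter k) b
            (c.counter k b + δ * f.slope k * |(c.sur I k : ℝ)|) := by
          funext b'
          change c.counter k b' + δ * c.rate f I k b' = _
          by_cases hbb : b' = b
          · subst hbb
            rw [Function.update_self, hr1]
            ring
          · obtain rfl : b' = !b := by cases b <;> cases b' <;> simp_all
            rw [Function.update_of_ne hbb, hr2]
            ring
        have hsum : δ * (c.rate f I k true + c.rate f I k false) =
            δ * f.slope k * |(c.sur I k : ℝ)| := by
          cases b <;> simp only [Bool.not_true, Bool.not_false] at hr2 <;> rw [hr1, hr2] <;> ring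
        rw [hupd, hsum]
        exact levelPotential_increase _ _ _ (mul_nonneg hδ hs) hb
      · have hsame : (c.advance f I δ).counter k = c.counter k := by
          funext b
          change c.counter k b + δ * c.rate f I k b = _
          rw [hr, mul_zero, add_zero]
        have h3 : 0 ≤ δ * f.slope k * |(otherSur f I p c k : ℝ)| := by positivity
        rw [hsame, hr, hr]
        linarith
    linarith
  · rw [potentialAt, potentialAt, if_neg hnext, if_neg hnext, otherSur_eq_sur h hp hpol hnext,
      otherSur_eq_sur h' hp hpol hnext, hsur, sub_self, abs_zero, mul_zero]
    have h1 := mul_le_mul_of_nonneg_left (c.rate_add_rate_le f I hk) hδ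
    have h2 : 0 ≤ δ * f.slope k * |(c.sur I k : ℝ)| := by positivity
    linarith

/-- The balance does not increase while time passes and no request of the solution compared with
leaves a level by ageing in the meantime; at the end of the interval, requests may do so. -/
lemma balance_advance_le_of_avoiding (h : Valid f I c) (hN : (N : ℕ∞) ≤ f.pieces)
    (hlev : ∀ r k, c.status r = .waiting k → k < N) (hp : ∀ r, p (p r) = r)
    (hpol : ∀ r, I.polarity (p r) ≠ I.polarity r) (hpair : ¬ c.HasPair I) {δ : ℝ} (hδ : 0 ≤ δ)
    (h' : Valid f I (c.advance f I δ))
    (hage : ∀ r, ∀ k < N, ¬ (c.time < I.arrival r + f.brk (k + 1) ∧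
      I.arrival r + f.brk (k + 1) < c.time + δ)) :
    balance f I p N (c.advance f I δ) ≤ balance f I p N c := by
  classical
  set R := ∑ k ∈ Finset.range N, (c.rate f I k true + c.rate f I k false) with hR
  set W : ι → ℝ → ℝ := fun r x => if OtherWaits p c r then x else 0 with hW
  have hWsum : ∀ (r : ι) (g : ℕ → ℝ),
      ∑ k ∈ Finset.range N, W r (g k) = W r (∑ k ∈ Finset.range N, g k) := by
    intro r g
    by_cases hr : OtherWaits p c r <;> simp [hW, hr]
  have hcost : algCost f I (c.advance f I δ) ≤ algCost f I c + 2 * (δ * R) := by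
    rw [algCost_advance f I hlev]
    have := mul_le_mul_of_nonneg_left (Config.sum_slope_mul_count_le f hpair hN) hδ
    linarith
  have hwait : ∑ k ∈ Finset.range N, δ * f.slope k * |(otherSur f I p c k : ℝ)| ≤
      ∑ r, W r (2 * (f.toFun (c.time + δ - I.arrival r) - f.toFun (c.time - I.arrival r))) := by
    calc ∑ k ∈ Finset.range N, δ * f.slope k * |(otherSur f I p c k : ℝ)|
        ≤ ∑ k ∈ Finset.range N, ∑ r, W r (δ *
            if f.Unfinished k (c.time - I.arrival r) then f.slope k else 0) := by
          refine Finset.sum_le_sum fun k hk => ?_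
          have hs := (f.slope_pos k (lt_of_lt_of_le (Nat.cast_lt.2 (Finset.mem_range.1 hk)) hN)).le
          refine (mul_le_mul_of_nonneg_left (abs_otherSur_le f I p c k)
            (mul_nonneg hδ hs)).trans (le_of_eq ?_)
          rw [Finset.mul_sum]
          refine Finset.sum_congr rfl fun r _ => ?_
          by_cases h1 : OtherWaits p c r <;>
            by_cases h2 : f.Unfinished k (c.time - I.arrival r) <;> simp [hW, h1, h2]
      _ = ∑ r, W r (δ * ∑ k ∈ Finset.range N,
            if f.Unfinished k (c.time - I.arrival r) then f.slope k else 0) := by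
          rw [Finset.sum_comm]
          refine Finset.sum_congr rfl fun r _ => ?_
          rw [hWsum, Finset.mul_sum]
      _ ≤ _ := by
          refine Finset.sum_le_sum fun r _ => ?_
          simp only [hW]
          split_ifs with hr
          · have hx : 0 ≤ c.time - I.arrival r := sub_nonneg.2 (h.arrival_le_time r hr.1)
            have := f.mul_sum_slope_le hN hx (y := c.time + δ - I.arrival r) (by linarith)
              fun k hk _ hlt => by
                by_contra! hgt
                exact hage r k hk ⟨by linarith, by linarith⟩
            have e : c.time + δ - I.arrival r - (c.time - I.arrival r) = δ := by ring
            rwa [e] at this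
          · exact le_rfl
  have hjump : ∑ k ∈ Finset.range N, f.capacity k *
        |(otherSur f I p (c.advance f I δ) k : ℝ) - otherSur f I p c k| ≤
      ∑ r, W r (f.finishedCapacity N (c.time + δ - I.arrival r) -
        f.finishedCapacity N (c.time - I.arrival r)) := by
    calc ∑ k ∈ Finset.range N, f.capacity k *
          |(otherSur f I p (c.advance f I δ) k : ℝ) - otherSur f I p c k|
        ≤ ∑ k ∈ Finset.range N, ∑ r, W r
            ((if f.Unfinished k (c.time + δ - I.arrival r) then 0 else f.capacity k) -
              (if f.Unfinished k (c.time - I.arrival r) then 0 else f.capacity k)) := by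
          refine Finset.sum_le_sum fun k hk => ?_
          by_cases hnext : f.HasNext k
          · refine (mul_le_mul_of_nonneg_left (abs_otherSur_advance_sub_le f I p c hδ k)
              hnext.capacity_pos.le).trans (le_of_eq ?_)
            rw [Finset.mul_sum]
            refine Finset.sum_congr rfl fun r _ => ?_
            by_cases h0 : OtherWaits p c r <;>
              by_cases h1 : f.Unfinished k (c.time + δ - I.arrival r) <;>
              by_cases h2 : f.Unfinished k (c.time - I.arrival r) <;> simp [hW, h0, h1, h2]
          · have hun : ∀ x, f.Unfinished k x := fun x hk' => absurd hk' hnext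
            rw [otherSur_eq_sur h hp hpol hnext, otherSur_eq_sur h' hp hpol hnext]
            have hsur : (c.advance f I δ).sur I k = c.sur I k := rfl
            simp [hsur, hun, hW]
      _ = _ := by
          rw [Finset.sum_comm]
          refine Finset.sum_congr rfl fun r _ => ?_
          rw [hWsum, Finset.sum_sub_distrib]
          rfl
  have hrel : releasedCost f I p N (c.advance f I δ) = releasedCost f I p N c +
      (3 * ∑ r, W r (2 * (f.toFun (c.time + δ - I.arrival r) - f.toFun (c.time - I.arrival r))) +
        3 * ∑ r, W r (f.finishedCapacity N (c.time + δ - I.arrival r) -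
          f.finishedCapacity N (c.time - I.arrival r))) := by
    rw [Finset.mul_sum, Finset.mul_sum, ← Finset.sum_add_distrib, releasedCost, releasedCost,
      ← Finset.sum_add_distrib]
    refine Finset.sum_congr rfl fun r _ => ?_
    have hst : (c.advance f I δ).status = c.status := rfl
    have ht : (c.advance f I δ).time = c.time + δ := rfl
    rw [hst, ht]
    simp only [hW, OtherWaits]
    by_cases h1 : c.status r = .future <;> by_cases h2 : c.status (p r) = .future <;>
      simp [h1, h2]
    ring
  have hlevels : ∑ k ∈ Finset.range N, ((c.advance f I δ).counter k true +
        (c.advance f I δ).counter k false + 3 * potentialAt f I p (c.advance f I δ) k) ≤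
      ∑ k ∈ Finset.range N,
        (c.counter k true + c.counter k false + 3 * potentialAt f I p c k) - 2 * (δ * R) +
      9 * ∑ k ∈ Finset.range N, δ * f.slope k * |(otherSur f I p c k : ℝ)| +
      9 * ∑ k ∈ Finset.range N, f.capacity k *
        |(otherSur f I p (c.advance f I δ) k : ℝ) - otherSur f I p c k| := by
    rw [hR, Finset.mul_sum, Finset.mul_sum, Finset.mul_sum, Finset.mul_sum,
      ← Finset.sum_sub_distrib, ← Finset.sum_add_distrib, ← Finset.sum_add_distrib]
    refine Finset.sum_le_sum fun k hk => ?_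
    have hkN := lt_of_lt_of_le (Nat.cast_lt.2 (Finset.mem_range.1 hk)) hN
    have := potentialAt_advance_le h hp hpol hδ h' hkN
    have e : ∀ b, (c.advance f I δ).counter k b = c.counter k b + δ * c.rate f I k b :=
      fun _ => rfl
    rw [e, e]
    linarith
  simp only [balance, hrel]
  linarith

lemma balance_advance_le (h : Valid f I c) (hN : (N : ℕ∞) ≤ f.pieces)
    (hlev : ∀ r k, c.status r = .waiting k → k < N) (hp : ∀ r, p (p r) = r)
    (hpol : ∀ r, I.polarity (p r) ≠ I.polarity r) (hpair : ¬ c.HasPair I) {δ : ℝ} (hδ : 0 ≤ δ)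
    (hfut : ∀ r, c.status r = .future → c.time + δ ≤ I.arrival r)
    (hcap : ∀ k b, c.Active I k b → f.HasNext k →
      c.counter k b + δ * c.rate f I k b ≤ f.capacity k) :
    balance f I p N (c.advance f I δ) ≤ balance f I p N c := by
  classical
  have hvalid : ∀ s, 0 ≤ s → s ≤ δ → Valid f I (c.advance f I s) := by
    intro s hs hsδ
    refine h.advance hs (fun r hr => ?_) fun k b hact hk => ?_
    · linarith [hfut r hr]
    · have := mul_le_mul_of_nonneg_right hsδ (c.rate_nonneg f I hk.lt_pieces b)
      linarith [hcap k b hact hk]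
  have := le_of_forall_avoiding (F := fun s => balance f I p N (c.advance f I s))
    ((Finset.univ ×ˢ Finset.range N).image fun x : ι × ℕ =>
      I.arrival x.1 + f.brk (x.2 + 1) - c.time) hδ ?_
  · simpa only [Config.advance_zero] using this
  · intro s t hs hst ht havoid
    have hadd : (c.advance f I s).advance f I (t - s) = c.advance f I t := by
      rw [Config.advance_advance, add_sub_cancel]
    simp only [← hadd]
    refine balance_advance_le_of_avoiding (hvalid s hs (hst.trans ht)) hN hlev hp hpol hpair
      (sub_nonneg.2 hst) (hadd ▸ hvalid t (hs.trans hst) ht) fun r k hk hrk => ?_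
    refine havoid _ (Finset.mem_image.2
      ⟨(r, k), Finset.mem_product.2 ⟨Finset.mem_univ r, Finset.mem_range.2 hk⟩, rfl⟩) ?_
    obtain ⟨h1, h2⟩ := hrk
    change c.time + s < _ at h1
    change _ < c.time + s + (t - s) at h2
    constructor <;> linarith

end waiting

/-! ### The competitive ratio -/

section competitive

variable {f : PiecewiseLinearDelay} {I : Input ι} {p : ι → ι} {N : ℕ} {c : Config ι}

lemma Step.balance_le [DecidableEq ι] (h : Valid f I c) (hN : (N : ℕ∞) ≤ f.pieces)
    (hlev : ∀ r k, c.status r = .waiting k → k < N) (hp : ∀ r, p (p r) = r)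
    (hpol : ∀ r, I.polarity (p r) ≠ I.polarity r) {c' : Config ι} (hstep : Step f I c c') :
    balance f I p N c' ≤ balance f I p N c := by
  cases hstep with
  | arrive r hr ht => exact balance_arrive_le h hp hpol hr ht
  | pair k r s hr hs hrk hsk => exact balance_pair_le h hr hs hrk hsk
  | move k b r hpair hk hact hfull hr hrk => exact balance_move_le h hlev hk hfull hr hrk
  | wait δ hδ hpair hfut hcap hnext =>
    exact balance_advance_le h hN hlev hp hpol hpair hδ.le hfut hcap

lemma balance_init (f : PiecewiseLinearDelay) (I : Input ι) (p : ι → ι) (N : ℕ) :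
    balance f I p N (Config.init ι) = 0 := by
  have hsur : ∀ k, (Config.init ι).sur I k = 0 := by
    intro k
    rw [Config.sur_eq_sum]
    exact Finset.sum_eq_zero fun r _ => rfl
  have hosur : ∀ k, otherSur f I p (Config.init ι) k = 0 := fun k =>
    Finset.sum_eq_zero fun r _ => if_neg fun h => h.1.1 rfl
  have hpot : ∀ k, potentialAt f I p (Config.init ι) k = 0 := by
    intro k
    rw [potentialAt, hsur, hosur, sub_zero, levelPotential_zero]
    simp [Config.init]
  have hrel : releasedCost f I p N (Config.init ι) = 0 :=
    Finset.sum_eq_zero fun r _ => if_pos rfl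
  have hcost : algCost f I (Config.init ι) = 0 := Finset.sum_eq_zero fun r _ => rfl
  have hctr : ∀ k b, (Config.init ι).counter k b = 0 := fun _ _ => rfl
  simp [balance, hpot, hrel, hcost, hctr]

lemma algCost_le [DecidableEq ι] (hreach : Reachable f I c) (hp : ∀ r, p (p r) = r)
    (hpol : ∀ r, I.polarity (p r) ≠ I.polarity r) :
    ∃ N, algCost f I c ≤ 3 * releasedCost f I p N c := by
  obtain ⟨N, hN, hlev⟩ := exists_level_bound f I
  have hbal : balance f I p N c ≤ 0 := by
    rw [← balance_init f I p N]
    induction hreach with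
    | refl => exact le_rfl
    | tail hreach hstep ih =>
      have hv := Reachable.valid hreach
      exact (hstep.balance_le hv hN (hlev _ hv) hp hpol).trans ih
  have hsum : 0 ≤ ∑ k ∈ Finset.range N,
      (c.counter k true + c.counter k false + 3 * potentialAt f I p c k) := by
    refine Finset.sum_nonneg fun k _ => ?_
    have h1 := hreach.valid.counter_nonneg k true
    have h2 := hreach.valid.counter_nonneg k false
    have h3 := potentialAt_nonneg (p := p) hreach.valid k
    linarith
  refine ⟨N, ?_⟩
  rw [balance] at hbal
  linarith

/-- Matching each pair at the later of its two arrivals costs the solution at most what it pays. -/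
lemma PerfectMatching.sum_toFun_abs_le (M : PerfectMatching I) (f : PiecewiseLinearDelay) :
    ∑ r, f.toFun |I.arrival r - I.arrival (M.partner r)| ≤ 2 * M.cost f.toFun := by
  have hinv : ∑ r, f.toFun (M.time (M.partner r) - I.arrival (M.partner r)) =
      M.cost f.toFun :=
    Function.Bijective.sum_comp (Function.Involutive.bijective M.partner_partner)
      fun r => f.toFun (M.time r - I.arrival r)
  rw [two_mul]
  nth_rewrite 1 [← hinv]
  rw [PerfectMatching.cost, ← Finset.sum_add_distrib]
  refine Finset.sum_le_sum fun r _ => ?_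
  have h1 := M.arrival_le_time r
  have h2 := M.arrival_le_time (M.partner r)
  have h3 := M.time_partner r
  have n1 := f.toFun_nonneg (sub_nonneg.2 h1)
  have n2 := f.toFun_nonneg (sub_nonneg.2 h2)
  rcases le_total (I.arrival r) (I.arrival (M.partner r)) with hle | hle
  · have := f.monotoneOn (Set.mem_Ici.2 (abs_nonneg (I.arrival r - I.arrival (M.partner r))))
      (Set.mem_Ici.2 (sub_nonneg.2 h1)) (by rw [abs_of_nonpos (by linarith)]; linarith)
    linarith
  · have := f.monotoneOn (Set.mem_Ici.2 (abs_nonneg (I.arrival r - I.arrival (M.partner r))))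
      (Set.mem_Ici.2 (sub_nonneg.2 h2)) (by rw [abs_of_nonneg (by linarith)]; linarith)
    linarith

lemma PerfectMatching.cost_nonneg (M : PerfectMatching I) {D : ℝ → ℝ}
    (hD : ∀ x, 0 ≤ x → 0 ≤ D x) : 0 ≤ M.cost D :=
  Finset.sum_nonneg fun r _ => hD _ (sub_nonneg.2 (M.arrival_le_time r))

/-- A run that has come to its end has matched all requests, at a cost that is at most `36` times
that of any other perfect matching. -/
theorem exists_perfectMatching_of_terminal [DecidableEq ι] (hreach : Reachable f I c)
    (hterm : ∀ c', ¬ Step f I c c') :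
    ∃ M : PerfectMatching I, (∀ r, c.status r = .matched (M.partner r) (M.time r)) ∧
      ∀ M' : PerfectMatching I, M.cost f.toFun ≤ 36 * M'.cost f.toFun := by
  have hv := hreach.valid
  have hall : ∀ r, ∃ s m, c.status r = .matched s m := by
    by_contra! hcon
    obtain ⟨c', hc'⟩ := hv.exists_step hcon
    exact hterm c' hc'
  choose q m hq using hall
  have hqq : ∀ r, c.status (q r) = .matched r (m r) := fun r => (hv.matched r _ _ (hq r)).1
  have hinj : ∀ r, q (q r) = r ∧ m (q r) = m r := by
    intro r
    have := (hq (q r)).symm.trans (hqq r)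
    exact Status.matched.injEq .. ▸ this
  let M : PerfectMatching I :=
    { partner := q
      time := m
      partner_partner := fun r => (hinj r).1
      polarity_partner := fun r => (hv.matched r _ _ (hq r)).2.1
      time_partner := fun r => (hinj r).2
      arrival_le_time := fun r => (hv.matched r _ _ (hq r)).2.2 }
  refine ⟨M, hq, fun M' => ?_⟩
  obtain ⟨N, hle⟩ := algCost_le hreach M'.partner_partner M'.polarity_partner
  have hcost : algCost f I c = M.cost f.toFun := by
    refine Finset.sum_congr rfl fun r _ => ?_
    rw [hq r]
    rfl
  have hrel : releasedCost f I M'.partner N c =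
      6 * ∑ r, f.toFun |I.arrival r - I.arrival (M'.partner r)| := by
    rw [Finset.mul_sum]
    refine Finset.sum_congr rfl fun r _ => ?_
    rw [if_neg (by simp [hq]), if_neg (by simp [hq])]
  have := M'.sum_toFun_abs_le f
  rw [hcost, hrel] at hle
  linarith

end competitive

end ConcaveMatching

theorem mainTheorem1 (D : ℝ → ℝ) (hD : ConcaveMatching.IsConcaveDelay D) :
    (∃ f : ConcaveMatching.PiecewiseLinearDelay, f.Approximates D) ∧
    ∀ f : ConcaveMatching.PiecewiseLinearDelay, f.Approximates D →
      ∀ {ι : Type*} [Fintype ι] [DecidableEq ι] (I : ConcaveMatching.Input ι),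
        -- no run is infinite
        (¬ ∃ run : ℕ → ConcaveMatching.Config ι, run 0 = ConcaveMatching.Config.init ι ∧
          ∀ n, ConcaveMatching.Step f I (run n) (run (n + 1))) ∧
        -- every run that has come to its end has produced a perfect matching of bounded cost
        ∀ c : ConcaveMatching.Config ι, ConcaveMatching.Reachable f I c →
          (∀ c' : ConcaveMatching.Config ι, ¬ ConcaveMatching.Step f I c c') →
          ∃ M : ConcaveMatching.PerfectMatching I,
            (∀ r, c.status r = ConcaveMatching.Status.matched (M.partner r) (M.time r)) ∧
            M.cost f.toFun ≤ 36 * I.opt f.toFun ∧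
            M.cost D ≤ 72 * I.opt D := by
  refine ⟨hD.exists_approximates, fun f happ ι _ _ I =>
    ⟨ConcaveMatching.not_exists_infinite_run f I, fun c hreach hterm => ?_⟩⟩
  obtain ⟨M, hM, hcost⟩ := ConcaveMatching.exists_perfectMatching_of_terminal hreach hterm
  have : Nonempty (ConcaveMatching.PerfectMatching I) := ⟨M⟩
  have hf : M.cost f.toFun ≤ 36 * I.opt f.toFun := by
    rw [← div_le_iff₀' (by norm_num)]
    refine le_ciInf fun M' => ?_
    rw [div_le_iff₀' (by norm_num)]
    exact hcost M'
  have hopt : I.opt f.toFun ≤ I.opt D := by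
    refine ciInf_mono ⟨0, ?_⟩ fun M' => Finset.sum_le_sum fun r _ =>
      (happ _ (sub_nonneg.2 (M'.arrival_le_time r))).1
    rintro _ ⟨M', rfl⟩
    exact M'.cost_nonneg fun x hx => f.toFun_nonneg hx
  have hDf : M.cost D ≤ 2 * M.cost f.toFun := by
    rw [ConcaveMatching.PerfectMatching.cost, ConcaveMatching.PerfectMatching.cost,
      Finset.mul_sum]
    exact Finset.sum_le_sum fun r _ => (happ _ (sub_nonneg.2 (M.arrival_le_time r))).2
  exact ⟨M, hM, hf, by linarith⟩
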